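/- Let $\mathbb{G}$ be a coamenable locally compact quantum group in the sense of Kustermans and Vaes, with $C^*$-algebra $C_0(\mathbb{G})$ and comultiplication $\Delta : C_0(\mathbb{G}) \to M(C_0(\mathbb{G}) \otimes C_0(\mathbb{G}))$, where $\otimes$ is the spatial tensor product and $M(\cdot)$ the multiplier algebra. Put $C_b(\mathbb{G}) = M(C_0(\mathbb{G}))$ and let $M(\mathbb{G}) = C_0(\mathbb{G})^*$ carry the convolution product $\omega \star \mu = (\omega \otimes \mu) \circ \Delta$. Bounded functionals and $\Delta$ are extended strictly to multiplier algebras without change of notation. An idempotent functional is a nonzero $\omega \in M(\mathbb{G})$ with $\omega \star \omega = \omega$; it is called an idempotent state if it is a state, and a contractive idempotent if $\|\omega\| \le 1$. For $\omega \in M(\mathbb{G})$ and $x \in C_b(\mathbb{G})$ write $(x.\omega)(a) = \omega(ax)$ and $(\omega.x)(a) = \omega(xa)$, $a \in C_0(\mathbb{G})$. Let $\sigma \in M(\mathbb{G})$ be an idempotent state, and let $u \in C_b(\mathbb{G})$ satisfy $$\Delta(u) - u \otimes u \in N_{\sigma\otimes\sigma} := \{X \in M(C_0(\mathbb{G}) \otimes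 C_0(\mathbb{G})) : (\sigma\otimes\sigma)(X^*X) = 0\}.$$ Then either $\sigma(u^*u) = 1$ or $\sigma(u^*u) = 0$. If $\sigma(u^*u) = 1$, then $u.\sigma.u^*$ is an idempotent state, and $u.\sigma$ and $\sigma.u^*$ are contractive idempotents. -/

import Mathlib

open scoped TensorProduct ENNReal NNReal ComplexOrder
open Filter Topology

noncomputable section

namespace QG

/-! ### Tensor products of Hilbert spaces, operators and C*-algebras of operators -/

section HilbertTensor

variable {H K : Type*} [NormedAddCommGroup H] [InnerProductSpace ℂ H]
  [NormedAddCommGroup K] [InnerProductSpace ℂ K]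

/-- The Hilbert space tensor product: the completion of the algebraic tensor product for the
inner product `⟪ξ ⊗ η, ξ' ⊗ η'⟫ = ⟪ξ, ξ'⟫ * ⟪η, η'⟫`. -/
def HTensor (H K : Type*) [NormedAddCommGroup H] [InnerProductSpace ℂ H]
    [NormedAddCommGroup K] [InnerProductSpace ℂ K] : Type _ :=
  UniformSpace.Completion (H ⊗[ℂ] K)

instance : NormedAddCommGroup (HTensor H K) :=
  inferInstanceAs (NormedAddCommGroup (UniformSpace.Completion (H ⊗[ℂ] K)))

instance : InnerProductSpace ℂ (HTensor H K) :=
  inferInstanceAs (InnerProductSpace ℂ (UniformSpace.Completion (H ⊗[ℂ] K)))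

instance : CompleteSpace (HTensor H K) :=
  inferInstanceAs (CompleteSpace (UniformSpace.Completion (H ⊗[ℂ] K)))

/-- The canonical isometric embedding of the algebraic tensor product. -/
def ofAlg : (H ⊗[ℂ] K) →ₗᵢ[ℂ] HTensor H K :=
  (UniformSpace.Completion.toComplₗᵢ : (H ⊗[ℂ] K) →ₗᵢ[ℂ] UniformSpace.Completion (H ⊗[ℂ] K))

theorem denseRange_ofAlg : DenseRange (ofAlg : (H ⊗[ℂ] K) → HTensor H K) :=
  UniformSpace.Completion.denseRange_coe (α := H ⊗[ℂ] K)

/-- The elementary tensor `ξ ⊗ η` in the Hilbert space tensor product. -/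
def tmul (ξ : H) (η : K) : HTensor H K := ofAlg (ξ ⊗ₜ[ℂ] η)

/-- The operator `S ⊗ T` on the Hilbert space tensor product, the continuous extension of the
algebraic one. -/
def tensorOp (S : H →L[ℂ] H) (T : K →L[ℂ] K) : HTensor H K →L[ℂ] HTensor H K :=
  ((TensorProduct.mapL S T).completion :
    UniformSpace.Completion (H ⊗[ℂ] K) →L[ℂ] UniformSpace.Completion (H ⊗[ℂ] K))

theorem tensorOp_ofAlg (S : H →L[ℂ] H) (T : K →L[ℂ] K) (x : H ⊗[ℂ] K) :
    tensorOp S T (ofAlg x) = ofAlg (TensorProduct.mapL S T x) :=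
  ContinuousLinearMap.completion_apply_coe (TensorProduct.mapL S T) x

theorem tensorOp_tmul (S : H →L[ℂ] H) (T : K →L[ℂ] K) (ξ : H) (η : K) :
    tensorOp S T (tmul ξ η) = tmul (S ξ) (T η) :=
  tensorOp_ofAlg S T _

theorem tensorOp_mul (S S' : H →L[ℂ] H) (T T' : K →L[ℂ] K) :
    tensorOp S T * tensorOp S' T' = tensorOp (S * S') (T * T') := by
  ext x
  refine denseRange_ofAlg.induction_on x (isClosed_eq (by fun_prop) (by fun_prop)) fun x => ?_
  rw [mul_apply_eq_comp, tensorOp_ofAlg, tensorOp_ofAlg, tensorOp_ofAlg,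
    TensorProduct.mapL_mul, mul_apply_eq_comp]

end HilbertTensor

section Algebras

variable {H K : Type*} [NormedAddCommGroup H] [InnerProductSpace ℂ H] [CompleteSpace H]
  [NormedAddCommGroup K] [InnerProductSpace ℂ K] [CompleteSpace K]

theorem star_tensorOp (S : H →L[ℂ] H) (T : K →L[ℂ] K) :
    star (tensorOp S T) = tensorOp (star S) (star T) := by
  rw [ContinuousLinearMap.star_eq_adjoint, eq_comm, ContinuousLinearMap.eq_adjoint_iff]
  intro x y
  refine denseRange_ofAlg.induction_on₂ (p := fun x y =>
    inner ℂ (tensorOp (star S) (star T) x) y = inner ℂ x (tensorOp S T y))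
    (isClosed_eq (by fun_prop) (by fun_prop)) (fun x y => ?_) x y
  simp only [tensorOp_ofAlg, LinearIsometry.inner_map_map]
  induction x with
  | zero => simp
  | add x x' hx hx' => simp only [map_add, inner_add_left, hx, hx']
  | tmul ξ η =>
    induction y with
    | zero => simp
    | add y y' hy hy' => simp only [map_add, inner_add_right, hy, hy']
    | tmul ξ' η' =>
      simp [ContinuousLinearMap.star_eq_adjoint, ContinuousLinearMap.adjoint_inner_left]

/-- A C*-algebra of operators on `H` is nondegenerate if `A H` spans a dense subspace of `H`. -/
def IsNondegenerate (A : NonUnitalStarSubalgebra ℂ (H →L[ℂ] H)) : Prop :=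
  (Submodule.span ℂ {x : H | ∃ a ∈ A, ∃ ξ : H, x = a ξ}).topologicalClosure = ⊤

/-- The set of elementary tensors `a ⊗ b` with `a ∈ A`, `b ∈ B`. -/
def elemTensors (A : NonUnitalStarSubalgebra ℂ (H →L[ℂ] H))
    (B : NonUnitalStarSubalgebra ℂ (K →L[ℂ] K)) : Set (HTensor H K →L[ℂ] HTensor H K) :=
  {T | ∃ a ∈ A, ∃ b ∈ B, T = tensorOp a b}

theorem span_elemTensors_mul {A : NonUnitalStarSubalgebra ℂ (H →L[ℂ] H)}
    {B : NonUnitalStarSubalgebra ℂ (K →L[ℂ] K)} {S T : HTensor H K →L[ℂ] HTensor H K}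
    (hS : S ∈ Submodule.span ℂ (elemTensors A B)) (hT : T ∈ Submodule.span ℂ (elemTensors A B)) :
    S * T ∈ Submodule.span ℂ (elemTensors A B) := by
  have h := Submodule.mul_mem_mul hS hT
  rw [Submodule.span_mul_span] at h
  refine Submodule.span_mono ?_ h
  rintro _ ⟨_, ⟨a, ha, b, hb, rfl⟩, _, ⟨a', ha', b', hb', rfl⟩, rfl⟩
  exact ⟨a * a', mul_mem ha ha', b * b', mul_mem hb hb', tensorOp_mul _ _ _ _⟩

theorem span_elemTensors_star {A : NonUnitalStarSubalgebra ℂ (H →L[ℂ] H)}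
    {B : NonUnitalStarSubalgebra ℂ (K →L[ℂ] K)} {S : HTensor H K →L[ℂ] HTensor H K}
    (hS : S ∈ Submodule.span ℂ (elemTensors A B)) :
    star S ∈ Submodule.span ℂ (elemTensors A B) := by
  induction hS using Submodule.span_induction with
  | mem x hx =>
    obtain ⟨a, ha, b, hb, rfl⟩ := hx
    exact Submodule.subset_span ⟨star a, star_mem ha, star b, star_mem hb, star_tensorOp _ _⟩
  | zero => simp
  | add x y _ _ hx hy => rw [star_add]; exact add_mem hx hy
  | smul c x _ hx => rw [star_smul]; exact Submodule.smul_mem _ _ hx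

/-- The spatial (minimal) tensor product of two C*-algebras of operators: the closed linear span
of the elementary tensors `a ⊗ b` on the Hilbert space tensor product. -/
def minTensor (A : NonUnitalStarSubalgebra ℂ (H →L[ℂ] H))
    (B : NonUnitalStarSubalgebra ℂ (K →L[ℂ] K)) :
    NonUnitalStarSubalgebra ℂ (HTensor H K →L[ℂ] HTensor H K) where
  carrier := (Submodule.span ℂ (elemTensors A B)).topologicalClosure
  add_mem' := fun hx hy => add_mem hx hy
  zero_mem' := zero_mem _
  smul_mem' := fun c _ hx => Submodule.smul_mem _ c hx
  mul_mem' := fun hx hy =>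
    map_mem_closure₂ (f := fun x y => x * y) continuous_mul hx hy
      fun _ ha _ hb => span_elemTensors_mul ha hb
  star_mem' := fun hx =>
    map_mem_closure (f := star) continuous_star hx fun _ ha => span_elemTensors_star ha

/-- The elementary tensor `a ⊗ b` as an element of the spatial tensor product. -/
def elemTensor {A : NonUnitalStarSubalgebra ℂ (H →L[ℂ] H)}
    {B : NonUnitalStarSubalgebra ℂ (K →L[ℂ] K)} (a : A) (b : B) : minTensor A B :=
  ⟨tensorOp (a : H →L[ℂ] H) (b : K →L[ℂ] K),
    subset_closure (Submodule.subset_span ⟨a, a.2, b, b.2, rfl⟩)⟩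

/-- The multiplier algebra `M(A)` of a (nondegenerate) C*-algebra of operators: all operators
`m` with `m A ⊆ A` and `A m ⊆ A`. -/
def multiplier (A : NonUnitalStarSubalgebra ℂ (H →L[ℂ] H)) : StarSubalgebra ℂ (H →L[ℂ] H) where
  carrier := {m | ∀ a ∈ A, m * a ∈ A ∧ a * m ∈ A}
  mul_mem' := fun {m n} hm hn a ha =>
    ⟨by rw [mul_assoc]; exact (hm _ (hn a ha).1).1,
      by rw [← mul_assoc]; exact (hn _ (hm a ha).2).2⟩
  add_mem' := fun {m n} hm hn a ha =>
    ⟨by rw [add_mul]; exact add_mem (hm a ha).1 (hn a ha).1,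
      by rw [mul_add]; exact add_mem (hm a ha).2 (hn a ha).2⟩
  algebraMap_mem' := fun r a ha => by
    simp only [Algebra.algebraMap_eq_smul_one, smul_mul_assoc, one_mul, mul_smul_comm, mul_one,
      and_self]
    exact SMulMemClass.smul_mem r ha
  star_mem' := fun {m} hm a ha =>
    ⟨by simpa using star_mem (hm _ (star_mem ha)).2,
      by simpa using star_mem (hm _ (star_mem ha)).1⟩

/-- Left multiplication `a ↦ m a` of `A` by a multiplier. -/
def mulLeft {A : NonUnitalStarSubalgebra ℂ (H →L[ℂ] H)} (m : multiplier A) : A →L[ℂ] A where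
  toFun a := ⟨m * a, (m.2 a a.2).1⟩
  map_add' a b := Subtype.ext (mul_add _ _ _)
  map_smul' c a := Subtype.ext (mul_smul_comm _ _ _)
  cont := by fun_prop

/-- Right multiplication `a ↦ a m` of `A` by a multiplier. -/
def mulRight {A : NonUnitalStarSubalgebra ℂ (H →L[ℂ] H)} (m : multiplier A) : A →L[ℂ] A where
  toFun a := ⟨a * m, (m.2 a a.2).2⟩
  map_add' a b := Subtype.ext (add_mul _ _ _)
  map_smul' c a := Subtype.ext (smul_mul_assoc _ _ _)
  cont := by fun_prop

/-! ### Strict topology and strict extensions -/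

/-- The strict topology defined by `A`: the coarsest topology on operators making all the maps
`T ↦ T a` and `T ↦ a T`, `a ∈ A`, continuous into the norm topology. -/
abbrev strictTopology (A : NonUnitalStarSubalgebra ℂ (H →L[ℂ] H)) : TopologicalSpace (H →L[ℂ] H) :=
  ⨅ a : A, TopologicalSpace.induced (fun T => T * (a : H →L[ℂ] H)) inferInstance ⊓
    TopologicalSpace.induced (fun T => (a : H →L[ℂ] H) * T) inferInstance

/-- The filter on `A` of strict convergence to `m` inside the ball of radius `‖m‖`. -/
def strictFilter (A : NonUnitalStarSubalgebra ℂ (H →L[ℂ] H)) (m : H →L[ℂ] H) : Filter A :=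
  comap (fun a : A => (a : H →L[ℂ] H)) (@nhds _ (strictTopology A) m) ⊓ 𝓟 {a : A | ‖a‖ ≤ ‖m‖}

/-- The strict extension to `M(A)` of a bounded functional `ω` on `A`: its value at `m ∈ M(A)` is
the limit of `ω a` as `a ∈ A`, `‖a‖ ≤ ‖m‖`, converges strictly to `m`. -/
def strictExt {A : NonUnitalStarSubalgebra ℂ (H →L[ℂ] H)} (ω : StrongDual ℂ A)
    (m : H →L[ℂ] H) : ℂ :=
  limUnder (strictFilter A m) ω

/-- The strict extension to `M(A)` of a nondegenerate *-homomorphism `Φ` from `A` into operators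
on `K`: its value at `m ∈ M(A)` is the unique operator `T` with `T Φ(a) = Φ(m a)`, `a ∈ A`. -/
def homExt {A : NonUnitalStarSubalgebra ℂ (H →L[ℂ] H)} (Φ : A → (K →L[ℂ] K))
    (m : H →L[ℂ] H) : K →L[ℂ] K :=
  Classical.epsilon fun T => ∀ a b : A, (b : H →L[ℂ] H) = m * (a : H →L[ℂ] H) → T * Φ a = Φ b

/-! ### Functionals -/

/-- The product functional `ω ⊗ μ`: the unique bounded functional on the spatial tensor product
with `(ω ⊗ μ)(a ⊗ b) = ω(a) μ(b)`. -/
def tensorFunctional {A : NonUnitalStarSubalgebra ℂ (H →L[ℂ] H)}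
    {B : NonUnitalStarSubalgebra ℂ (K →L[ℂ] K)} (ω : StrongDual ℂ A) (μ : StrongDual ℂ B) :
    StrongDual ℂ (minTensor A B) :=
  Classical.epsilon fun f => ∀ (a : A) (b : B), f (elemTensor a b) = ω a * μ b

/-- The slice `(ω ⊗ id)(X)`, for `X` such that it lies in `B`: the element `b` of `B` determined
by `μ(b) = (ω ⊗ μ)(X)` for all functionals `μ` on `B`. -/
def sliceLeft {A : NonUnitalStarSubalgebra ℂ (H →L[ℂ] H)}
    {B : NonUnitalStarSubalgebra ℂ (K →L[ℂ] K)} (ω : StrongDual ℂ A)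
    (X : HTensor H K →L[ℂ] HTensor H K) : B :=
  Classical.epsilon fun b => ∀ μ : StrongDual ℂ B, μ b = strictExt (tensorFunctional ω μ) X

/-- The slice `(id ⊗ ω)(X)`, for `X` such that it lies in `A`. -/
def sliceRight {A : NonUnitalStarSubalgebra ℂ (H →L[ℂ] H)}
    {B : NonUnitalStarSubalgebra ℂ (K →L[ℂ] K)} (ω : StrongDual ℂ B)
    (X : HTensor H K →L[ℂ] HTensor H K) : A :=
  Classical.epsilon fun a => ∀ μ : StrongDual ℂ A, μ a = strictExt (tensorFunctional μ ω) X

/-- Positive functionals. -/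
def IsPositiveFunctional {A : NonUnitalStarSubalgebra ℂ (H →L[ℂ] H)} (ω : StrongDual ℂ A) :
    Prop :=
  ∀ a : A, 0 ≤ ω (star a * a)

/-- States: positive functionals of norm one. -/
def IsState {A : NonUnitalStarSubalgebra ℂ (H →L[ℂ] H)} (ω : StrongDual ℂ A) : Prop :=
  IsPositiveFunctional ω ∧ ‖ω‖ = 1

/-- `N_ω = {X ∈ M(A) : ω(X* X) = 0}`. -/
def nullSpace {A : NonUnitalStarSubalgebra ℂ (H →L[ℂ] H)} (ω : StrongDual ℂ A) :
    Set (H →L[ℂ] H) :=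
  {X | X ∈ multiplier A ∧ strictExt ω (star X * X) = 0}

/-- `(x.ω)(y) = ω(y x)`. -/
def leftAct {A : NonUnitalStarSubalgebra ℂ (H →L[ℂ] H)} (x : multiplier A)
    (ω : StrongDual ℂ A) : StrongDual ℂ A :=
  ω ∘L mulRight x

/-- `(ω.x)(y) = ω(x y)`. -/
def rightAct {A : NonUnitalStarSubalgebra ℂ (H →L[ℂ] H)} (ω : StrongDual ℂ A)
    (x : multiplier A) : StrongDual ℂ A :=
  ω ∘L mulLeft x

/-! ### KMS weights -/

/-- Positivity of an element of `A`. -/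
def IsPos {A : NonUnitalStarSubalgebra ℂ (H →L[ℂ] H)} (a : A) : Prop :=
  (a : H →L[ℂ] H).IsPositive

/-- `b` is the value at `a` of the analytic generator `α_{i/2}`: there is a function on the strip
`0 ≤ Im z ≤ 1/2`, continuous there and analytic inside, that extends `t ↦ α_t(a)` and takes the
value `b` at `i/2`. -/
def IsHalfShift {A : NonUnitalStarSubalgebra ℂ (H →L[ℂ] H)} (α : ℝ → (A ≃⋆ₐ[ℂ] A))
    (a b : A) : Prop :=
  ∃ f : ℂ → A, DiffContOnCl ℂ f {z : ℂ | 0 < z.im ∧ z.im < 1 / 2} ∧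
    (∀ t : ℝ, f t = α t a) ∧ f (Complex.I / 2) = b

/-- Faithful KMS weights on `A`: densely defined, lower semicontinuous, faithful weights that are
KMS for a norm continuous one-parameter group of *-automorphisms. Only the values of `φ` on
positive elements are meaningful. -/
structure IsFaithfulKMSWeight {A : NonUnitalStarSubalgebra ℂ (H →L[ℂ] H)} (φ : A → ℝ≥0∞) :
    Prop where
  add : ∀ a b, IsPos a → IsPos b → φ (a + b) = φ a + φ b
  smul : ∀ (r : ℝ≥0) (a : A), IsPos a → φ (((r : ℝ) : ℂ) • a) = r * φ a
  lsc : LowerSemicontinuousOn φ {a | IsPos a}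
  dense : {a | IsPos a} ⊆ closure {a | IsPos a ∧ φ a < ∞}
  faithful : ∀ a, IsPos a → φ a = 0 → a = 0
  kms : ∃ α : ℝ → (A ≃⋆ₐ[ℂ] A),
    (∀ a, α 0 a = a) ∧ (∀ s t a, α (s + t) a = α s (α t a)) ∧
    (∀ a, Continuous fun t => α t a) ∧
    (∀ t a, IsPos a → φ (α t a) = φ a) ∧
    ∀ a b, IsHalfShift α a b → φ (star a * a) = φ (b * star b)

end Algebras

/-! ### Locally compact quantum groups -/

section QuantumGroups

variable {H : Type*} [NormedAddCommGroup H] [InnerProductSpace ℂ H] [CompleteSpace H]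

/-- `Δ ⊗ id` on `A ⊗ A`: the unique bounded linear map with `a ⊗ b ↦ Δ(a) ⊗ b`. -/
def comulTensorId {A : NonUnitalStarSubalgebra ℂ (H →L[ℂ] H)}
    (Δ : A → (HTensor H H →L[ℂ] HTensor H H)) :
    minTensor A A →L[ℂ] (HTensor (HTensor H H) H →L[ℂ] HTensor (HTensor H H) H) :=
  Classical.epsilon fun Φ => ∀ a b : A, Φ (elemTensor a b) = tensorOp (Δ a) (b : H →L[ℂ] H)

/-- `id ⊗ Δ` on `A ⊗ A`: the unique bounded linear map with `a ⊗ b ↦ a ⊗ Δ(b)`. -/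
def idTensorComul {A : NonUnitalStarSubalgebra ℂ (H →L[ℂ] H)}
    (Δ : A → (HTensor H H →L[ℂ] HTensor H H)) :
    minTensor A A →L[ℂ] (HTensor H (HTensor H H) →L[ℂ] HTensor H (HTensor H H)) :=
  Classical.epsilon fun Φ => ∀ a b : A, Φ (elemTensor a b) = tensorOp (a : H →L[ℂ] H) (Δ b)

/-- Equality of an operator on `(H ⊗ H) ⊗ H` and one on `H ⊗ (H ⊗ H)` under the canonical
identification of the two spaces, tested on elementary tensors (which span dense subspaces). -/
def AssocEq (S : HTensor (HTensor H H) H →L[ℂ] HTensor (HTensor H H) H)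
    (T : HTensor H (HTensor H H) →L[ℂ] HTensor H (HTensor H H)) : Prop :=
  ∀ ξ₁ ξ₂ ξ₃ η₁ η₂ η₃ : H,
    inner ℂ (tmul (tmul ξ₁ ξ₂) ξ₃) (S (tmul (tmul η₁ η₂) η₃)) =
      inner ℂ (tmul ξ₁ (tmul ξ₂ ξ₃)) (T (tmul η₁ (tmul η₂ η₃)))

/-- A locally compact quantum group, given by the C*-algebra `alg = C₀(G)`, faithfully and
nondegenerately represented on a Hilbert space `H`, with its comultiplication
`Δ : C₀(G) → M(C₀(G) ⊗ C₀(G))`, satisfying the cancellation laws and admitting a left and a right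
Haar weight. -/
structure LCQG (H : Type*) [NormedAddCommGroup H] [InnerProductSpace ℂ H]
    [CompleteSpace H] where
  alg : NonUnitalStarSubalgebra ℂ (H →L[ℂ] H)
  isClosed_alg : IsClosed (alg : Set (H →L[ℂ] H))
  nondegenerate_alg : IsNondegenerate alg
  Δ : alg →⋆ₙₐ[ℂ] (HTensor H H →L[ℂ] HTensor H H)
  comul_mem : ∀ a, Δ a ∈ multiplier (minTensor alg alg)
  /-- `Δ` is nondegenerate: `Δ(A)(A ⊗ A)` spans a dense subspace of `A ⊗ A`. -/
  comul_nondegenerate :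
    ((Submodule.span ℂ {T : HTensor H H →L[ℂ] HTensor H H |
      ∃ a : alg, ∃ X ∈ minTensor alg alg, T = Δ a * X}).topologicalClosure :
        Set (HTensor H H →L[ℂ] HTensor H H)) = minTensor alg alg
  /-- Coassociativity: `(Δ ⊗ id) Δ = (id ⊗ Δ) Δ`. -/
  coassoc : ∀ a, AssocEq (homExt (comulTensorId Δ) (Δ a)) (homExt (idTensorComul Δ) (Δ a))
  /-- `Δ(A)(A ⊗ 1)` spans a dense subspace of `A ⊗ A`. -/
  cancel_left :
    ((Submodule.span ℂ {T : HTensor H H →L[ℂ] HTensor H H |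
      ∃ a b : alg, T = Δ a * tensorOp (b : H →L[ℂ] H) 1}).topologicalClosure :
        Set (HTensor H H →L[ℂ] HTensor H H)) = minTensor alg alg
  /-- `Δ(A)(1 ⊗ A)` spans a dense subspace of `A ⊗ A`. -/
  cancel_right :
    ((Submodule.span ℂ {T : HTensor H H →L[ℂ] HTensor H H |
      ∃ a b : alg, T = Δ a * tensorOp 1 (b : H →L[ℂ] H)}).topologicalClosure :
        Set (HTensor H H →L[ℂ] HTensor H H)) = minTensor alg alg
  /-- There is a left Haar weight: `φ((ω ⊗ id)Δ(a)) = ω(1) φ(a)`. -/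
  exists_leftHaar : ∃ φ : alg → ℝ≥0∞, IsFaithfulKMSWeight φ ∧
    ∀ ω : StrongDual ℂ alg, IsPositiveFunctional ω → ∀ a, IsPos a → φ a < ∞ →
      φ (sliceLeft ω (Δ a)) = ENNReal.ofReal (strictExt ω 1).re * φ a
  /-- There is a right Haar weight: `ψ((id ⊗ ω)Δ(a)) = ω(1) ψ(a)`. -/
  exists_rightHaar : ∃ ψ : alg → ℝ≥0∞, IsFaithfulKMSWeight ψ ∧
    ∀ ω : StrongDual ℂ alg, IsPositiveFunctional ω → ∀ a, IsPos a → ψ a < ∞ →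
      ψ (sliceRight ω (Δ a)) = ENNReal.ofReal (strictExt ω 1).re * ψ a

/-- `G` is coamenable if it has a bounded counit: `(ε ⊗ id)Δ = (id ⊗ ε)Δ = id`. -/
def LCQG.IsCoamenable (G : LCQG H) : Prop :=
  ∃ ε : StrongDual ℂ G.alg, ∀ a, sliceLeft ε (G.Δ a) = a ∧ sliceRight ε (G.Δ a) = a

/-- The convolution `ω ⋆ μ = (ω ⊗ μ) ∘ Δ` of functionals on `C₀(G)`. -/
def LCQG.conv (G : LCQG H) (ω μ : StrongDual ℂ G.alg) (a : G.alg) : ℂ :=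
  strictExt (tensorFunctional ω μ) (G.Δ a)

/-- Idempotent functionals: `ω ≠ 0` and `ω ⋆ ω = ω`. -/
def LCQG.IsIdempotent (G : LCQG H) (ω : StrongDual ℂ G.alg) : Prop :=
  ω ≠ 0 ∧ ∀ a, G.conv ω ω a = ω a

/-- Idempotent states. -/
def LCQG.IsIdempotentState (G : LCQG H) (ω : StrongDual ℂ G.alg) : Prop :=
  IsState ω ∧ G.IsIdempotent ω

/-- Contractive idempotents. -/
def LCQG.IsContractiveIdempotent (G : LCQG H) (ω : StrongDual ℂ G.alg) : Prop :=
  ‖ω‖ ≤ 1 ∧ G.IsIdempotent ω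

end QuantumGroups

end QG

end

/-! Positive functionals satisfy the Cauchy–Schwarz inequality. Hence a null element X of `σ ⊗ σ`
gives (σ ⊗ σ)(Y X) = 0 and (σ ⊗ σ)(X* Y) = 0 for every multiplier Y. Let u and v both be group-like
modulo this null space. Under `σ ⊗ σ` one may then replace u ⊗ u by Δ(u) on the right and (v ⊗ v)*
by Δ(v)* on the left, so that (σ ⊗ σ)((v ⊗ v)* Δ(a) (u ⊗ u)) = (σ ⊗ σ)(Δ(v* a u)) = σ(v* a u), the
last step being idempotence of σ (`strictExt_tensor_comul`). The left side is the convolution square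
of u.σ.v* at a, so u.σ.v* is fixed by squaring (`conv_compress`). Since 1 is exactly group-like, the
pairs (u, u), (u, 1) and (1, u) give all three idempotents. Taking v = u and letting a run through
an approximate unit turns the same identity into σ(u*u)² = σ(u*u), hence the dichotomy. The norm
bounds are again Cauchy–Schwarz.

The rest of the work makes these manipulations legitimate, because strict extensions, product
functionals and the extension of Δ are defined by limits or choice. Strict continuity of a positive
functional ω on bounded sets comes from approximating ω in norm by ω(e ·) with e in the algebra
(`exists_positiveFunctional_sub_mul_left_le`). Product functionals exist because slices are bounded
for the spatial norm (`norm_algSliceLeft_le`), and they are positive by the Schur product theorem.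
The extension of Δ exists by nondegeneracy (`homExt_mul`). -/

noncomputable section

namespace QG

/-! ### Positive functionals on an abstract C*-algebra -/

section PositiveFunctionals

variable {A : Type*} [NonUnitalCStarAlgebra A] {ω : StrongDual ℂ A}

/-- A positive functional as a positive linear map for the spectral order. -/
def toPositiveLinearMap (hω : ∀ a, 0 ≤ ω (star a * a)) :
    letI := CStarAlgebra.spectralOrder A
    A →ₚ[ℂ] ℂ :=
  letI := CStarAlgebra.spectralOrder A
  letI := CStarAlgebra.spectralOrderedRing A
  .mk₀ ω.toLinearMap fun x hx => by
    obtain ⟨y, rfl⟩ := CStarAlgebra.nonneg_iff_eq_star_mul_self.1 hx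
    exact hω y

theorem toPositiveLinearMap_apply (hω : ∀ a, 0 ≤ ω (star a * a)) (a : A) :
    letI := CStarAlgebra.spectralOrder A
    toPositiveLinearMap hω a = ω a :=
  rfl

theorem positiveFunctional_star (hω : ∀ a, 0 ≤ ω (star a * a)) (a : A) :
    ω (star a) = star (ω a) :=
  letI := CStarAlgebra.spectralOrder A
  letI := CStarAlgebra.spectralOrderedRing A
  map_star (toPositiveLinearMap hω) a

/-- This is the Cauchy–Schwarz inequality of the pre-GNS space of `ω`. -/
theorem positiveFunctional_cauchySchwarz (hω : ∀ a, 0 ≤ ω (star a * a)) (a b : A) :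
    ‖ω (star a * b)‖ ^ 2 ≤ ‖ω (star a * a)‖ * ‖ω (star b * b)‖ := by
  let _ := CStarAlgebra.spectralOrder A
  let _ := CStarAlgebra.spectralOrderedRing A
  set f := toPositiveLinearMap hω
  have h := norm_inner_le_norm (𝕜 := ℂ) (f.toPreGNS a) (f.toPreGNS b)
  have ha : ‖f.toPreGNS a‖ ^ 2 = ‖ω (star a * a)‖ := by
    have := congrArg norm (f.preGNS_norm_sq (f.toPreGNS a))
    simpa [f, toPositiveLinearMap_apply] using this
  have hb : ‖f.toPreGNS b‖ ^ 2 = ‖ω (star b * b)‖ := by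
    have := congrArg norm (f.preGNS_norm_sq (f.toPreGNS b))
    simpa [f, toPositiveLinearMap_apply] using this
  rw [← ha, ← hb, ← mul_pow]
  exact pow_le_pow_left₀ (norm_nonneg _) h 2

theorem mul_self_le_self_of_norm_le_one [PartialOrder A] [StarOrderedRing A] {d : A}
    (hd : 0 ≤ d) (hd' : ‖d‖ ≤ 1) : d * d ≤ d := by
  rw [← Unitization.inr_le_iff _ _ (by
    rw [isSelfAdjoint_iff, star_mul, hd.isSelfAdjoint.star_eq]) hd.isSelfAdjoint]
  have h0 : (0 : Unitization ℂ A) ≤ d := by rwa [Unitization.inr_nonneg_iff]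
  have h1 : (d : Unitization ℂ A) ≤ 1 := by
    rw [← CStarAlgebra.norm_le_one_iff_of_nonneg _ h0, Unitization.norm_inr]; exact hd'
  have := CStarAlgebra.pow_antitone h0 h1 one_le_two
  simpa [sq] using this

/-- Take e almost maximizing ω on the positive part of the open unit ball. For x ≥ e in the
approximate unit, ω((x - e)²) ≤ ω(x - e) is small, so Cauchy–Schwarz makes ω((x - e) a) small
uniformly for bounded a; then let x tend to 1. This uniform approximation is the source of strict
continuity. -/
theorem exists_positiveFunctional_sub_mul_left_le (hω : ∀ a, 0 ≤ ω (star a * a)) {ε : ℝ}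
    (hε : 0 < ε) : ∃ e : A, ∀ a, ‖ω a - ω (e * a)‖ ≤ ε * ‖a‖ := by
  let _ := CStarAlgebra.spectralOrder A
  let _ := CStarAlgebra.spectralOrderedRing A
  have hpos : ∀ x : A, 0 ≤ x → 0 ≤ ω x := fun x hx => (toPositiveLinearMap hω).map_nonneg hx
  set S : Set ℝ := (fun x => (ω x).re) '' {x : A | 0 ≤ x ∧ ‖x‖ < 1}
  have hbdd : BddAbove S := by
    refine ⟨‖ω‖, ?_⟩
    rintro _ ⟨x, ⟨-, hx⟩, rfl⟩
    exact (Complex.re_le_norm _).trans ((ω.le_opNorm x).trans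
      (mul_le_of_le_one_right (norm_nonneg _) hx.le))
  have hne : S.Nonempty := ⟨_, 0, ⟨le_rfl, by simp⟩, rfl⟩
  -- The supremum is over the open ball, while the bound on the approximate unit is `‖x‖ ≤ 1`;
  -- scaling by r < 1 and letting r tend to 1 covers the boundary.
  have hle : ∀ x : A, 0 ≤ x → ‖x‖ ≤ 1 → (ω x).re ≤ sSup S := by
    intro x hx hx1
    have hcl : IsClosed {r : ℝ | r * (ω x).re ≤ sSup S} :=
      isClosed_le (by fun_prop) (by fun_prop)
    have hsub : Set.Ioo (0 : ℝ) 1 ⊆ {r : ℝ | r * (ω x).re ≤ sSup S} := by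
      intro r hr
      refine le_csSup hbdd ⟨(r : ℂ) • x, ⟨?_, ?_⟩, ?_⟩
      · rw [Complex.coe_smul]; exact smul_nonneg hr.1.le hx
      · rw [norm_smul, Complex.norm_real, Real.norm_of_nonneg hr.1.le]
        exact (mul_le_of_le_one_right hr.1.le hx1).trans_lt hr.2
      · simp
    have := hcl.closure_subset_iff.2 hsub
    rw [closure_Ioo zero_ne_one] at this
    simpa using this (Set.right_mem_Icc.2 zero_le_one)
  -- Cauchy–Schwarz will multiply this tolerance by ω(a* a) ≤ ‖ω‖ ‖a‖², which leaves at most ε²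
  -- ‖a‖²; the added 1 keeps the denominator positive.
  have hδ : 0 < ε ^ 2 / (‖ω‖ + 1) := by positivity
  obtain ⟨_, ⟨e, ⟨he0, he1⟩, rfl⟩, hes⟩ := exists_lt_of_lt_csSup hne (sub_lt_self (sSup S) hδ)
  refine ⟨e, fun a => ?_⟩
  have hU := CStarAlgebra.increasingApproximateUnit A
  have := hU.neBot
  have hlim : Tendsto (fun x => ‖ω (x * a) - ω (e * a)‖) (CStarAlgebra.approximateUnit A)
      (𝓝 ‖ω a - ω (e * a)‖) :=
    (((ω.continuous.tendsto a).comp (hU.tendsto_mul_right a)).sub_const _).norm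
  refine le_of_tendsto hlim ?_
  have hev : ∀ᶠ x in CStarAlgebra.approximateUnit A, e ≤ x :=
    (CStarAlgebra.hasBasis_approximateUnit A).eventually_iff.2 ⟨e, ⟨he0, he1⟩, fun x hx => hx.1⟩
  filter_upwards [hev, hU.eventually_norm] with x hex hx1
  have hx0 : 0 ≤ x := he0.trans hex
  have hd0 : 0 ≤ x - e := sub_nonneg.2 hex
  have hd1 : ‖x - e‖ ≤ 1 :=
    (CStarAlgebra.norm_le_norm_of_nonneg_of_le hd0 (sub_le_self x he0)).trans hx1
  have hcs := positiveFunctional_cauchySchwarz hω (x - e) a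
  rw [hd0.isSelfAdjoint.star_eq] at hcs
  have hdd : ‖ω ((x - e) * (x - e))‖ ≤ ε ^ 2 / (‖ω‖ + 1) := by
    have h1 := hpos _ (sub_nonneg.2 (mul_self_le_self_of_norm_le_one hd0 hd1))
    have h2 : 0 ≤ ω ((x - e) * (x - e)) := by
      have := hω (x - e); rwa [hd0.isSelfAdjoint.star_eq] at this
    rw [map_sub] at h1
    have h3 := (Complex.le_def.1 (sub_nonneg.1 h1)).1
    have h4 := congrArg Complex.re (Complex.norm_of_nonneg' h2)
    rw [Complex.ofReal_re] at h4
    rw [h4]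
    refine h3.trans ?_
    rw [map_sub, Complex.sub_re]
    have := hle x hx0 hx1
    simp only at hes
    linarith
  rw [← map_sub, ← sub_mul]
  refine le_of_sq_le_sq ?_ (by positivity)
  have haa : ‖ω (star a * a)‖ ≤ (‖ω‖ + 1) * ‖a‖ ^ 2 := by
    refine (ω.le_opNorm _).trans ?_
    rw [CStarRing.norm_star_mul_self, ← sq]
    gcongr
    linarith
  calc _ ≤ _ := hcs
    _ ≤ ε ^ 2 / (‖ω‖ + 1) * ((‖ω‖ + 1) * ‖a‖ ^ 2) := by gcongr
    _ = _ := by field_simp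

end PositiveFunctionals

/-! ### Bounded strict convergence and strict extensions -/

section StrictConvergence

variable {H ι ι' : Type*} [NormedAddCommGroup H] [InnerProductSpace ℂ H] [CompleteSpace H]
  {A : NonUnitalStarSubalgebra ℂ (H →L[ℂ] H)}

/-- Bounded strict convergence: `f` is eventually bounded and converges to `m` in the strict
topology defined by `A`. -/
structure StrictTendsto (A : NonUnitalStarSubalgebra ℂ (H →L[ℂ] H)) (f : ι → (H →L[ℂ] H))
    (l : Filter ι) (m : H →L[ℂ] H) : Prop where
  bdd : ∃ C, ∀ᶠ i in l, ‖f i‖ ≤ C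
  mul_right : ∀ a ∈ A, Tendsto (fun i => f i * a) l (𝓝 (m * a))
  mul_left : ∀ a ∈ A, Tendsto (fun i => a * f i) l (𝓝 (a * m))

/-- Split f g = f (g - n) + f n; boundedness of f kills the first term. -/
theorem tendsto_mul_of_bdd {f g : ι → (H →L[ℂ] H)} {l : Filter ι} {m n : H →L[ℂ] H}
    (hf : ∃ C, ∀ᶠ i in l, ‖f i‖ ≤ C) (hg : Tendsto g l (𝓝 n))
    (h : Tendsto (fun i => f i * n) l (𝓝 m)) : Tendsto (fun i => f i * g i) l (𝓝 m) := by
  have h0 : Tendsto (fun i => f i * (g i - n)) l (𝓝 0) := by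
    obtain ⟨C, hC⟩ := hf
    have hg' : Tendsto (fun i => C * ‖g i - n‖) l (𝓝 0) := by
      simpa using ((hg.sub_const n).norm).const_mul C
    refine squeeze_zero_norm' ?_ hg'
    filter_upwards [hC] with i hi
    exact (norm_mul_le _ _).trans (by gcongr)
  simpa [mul_sub] using h0.add h

theorem tendsto_mul_of_bdd' {f g : ι → (H →L[ℂ] H)} {l : Filter ι} {m n : H →L[ℂ] H}
    (hg : ∃ C, ∀ᶠ i in l, ‖g i‖ ≤ C) (hf : Tendsto f l (𝓝 n))
    (h : Tendsto (fun i => n * g i) l (𝓝 m)) : Tendsto (fun i => f i * g i) l (𝓝 m) := by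
  have := tendsto_mul_of_bdd (f := fun i => star (g i)) (g := fun i => star (f i))
    (by simpa using hg) hf.star (by simpa using h.star)
  simpa using this.star

theorem coe_mem_multiplier (a : A) : (a : H →L[ℂ] H) ∈ multiplier A :=
  fun _ hb => ⟨mul_mem a.2 hb, mul_mem hb a.2⟩

namespace StrictTendsto

variable {f g : ι → (H →L[ℂ] H)} {l : Filter ι} {m n : H →L[ℂ] H}

theorem const (m : H →L[ℂ] H) : StrictTendsto A (fun _ : ι => m) l m :=
  ⟨⟨_, .of_forall fun _ => le_rfl⟩, fun _ _ => tendsto_const_nhds, fun _ _ => tendsto_const_nhds⟩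

/-- Boundedness gives joint continuity of the product, and the multiplier hypotheses keep n a and a
m inside `A`, where strict convergence of the other factor can be tested. -/
theorem mul (hf : StrictTendsto A f l m) (hg : StrictTendsto A g l n)
    (hm : m ∈ multiplier A) (hn : n ∈ multiplier A) :
    StrictTendsto A (fun i => f i * g i) l (m * n) where
  bdd := by
    obtain ⟨C, hC⟩ := hf.bdd
    obtain ⟨D, hD⟩ := hg.bdd
    refine ⟨C * D, ?_⟩
    filter_upwards [hC, hD] with i hi hi'
    exact (norm_mul_le _ _).trans
      (mul_le_mul hi hi' (norm_nonneg _) ((norm_nonneg _).trans hi))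
  mul_right a ha := by
    simp only [mul_assoc]
    exact tendsto_mul_of_bdd hf.bdd (hg.mul_right a ha) (hf.mul_right _ (hn a ha).1)
  mul_left a ha := by
    simp only [← mul_assoc]
    exact tendsto_mul_of_bdd' hg.bdd (hf.mul_left a ha) (hg.mul_left _ (hm a ha).2)

theorem star (hf : StrictTendsto A f l m) : StrictTendsto A (fun i => star (f i)) l (star m) where
  bdd := by simpa using hf.bdd
  mul_right a ha := by simpa using (hf.mul_left _ (star_mem ha)).star
  mul_left a ha := by simpa using (hf.mul_right _ (star_mem ha)).star

theorem sub (hf : StrictTendsto A f l m) (hg : StrictTendsto A g l n) :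
    StrictTendsto A (fun i => f i - g i) l (m - n) where
  bdd := by
    obtain ⟨C, hC⟩ := hf.bdd
    obtain ⟨D, hD⟩ := hg.bdd
    refine ⟨C + D, ?_⟩
    filter_upwards [hC, hD] with i hi hi'
    exact (norm_sub_le _ _).trans (add_le_add hi hi')
  mul_right a ha := by
    simpa only [sub_mul] using (hf.mul_right a ha).sub (hg.mul_right a ha)
  mul_left a ha := by
    simpa only [mul_sub] using (hf.mul_left a ha).sub (hg.mul_left a ha)

theorem comp {k : ι' → ι} {l' : Filter ι'} (hf : StrictTendsto A f l m) (hk : Tendsto k l' l) :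
    StrictTendsto A (fun i => f (k i)) l' m where
  bdd := let ⟨C, hC⟩ := hf.bdd; ⟨C, hk.eventually hC⟩
  mul_right a ha := (hf.mul_right a ha).comp hk
  mul_left a ha := (hf.mul_left a ha).comp hk

end StrictTendsto

theorem exists_approximateUnit (hA : IsClosed (A : Set (H →L[ℂ] H))) :
    ∃ l : Filter A, l.NeBot ∧ (∀ᶠ e in l, ‖e‖ ≤ 1) ∧
      StrictTendsto A (fun e : A => (e : H →L[ℂ] H)) l 1 := by
  let _ : NonUnitalCStarAlgebra A := NonUnitalStarSubalgebra.nonUnitalCStarAlgebra A (h_closed := hA)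
  let _ := CStarAlgebra.spectralOrder A
  let _ := CStarAlgebra.spectralOrderedRing A
  have hU := CStarAlgebra.increasingApproximateUnit A
  refine ⟨CStarAlgebra.approximateUnit A, hU.neBot, hU.eventually_norm,
    ⟨1, hU.eventually_norm⟩, fun a ha => ?_, fun a ha => ?_⟩
  · rw [one_mul]
    exact (continuous_subtype_val.tendsto _).comp (hU.tendsto_mul_right ⟨a, ha⟩)
  · rw [mul_one]
    exact (continuous_subtype_val.tendsto _).comp (hU.tendsto_mul_left ⟨a, ha⟩)

theorem nhds_strictTopology (m : H →L[ℂ] H) : @nhds _ (strictTopology A) m =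
    ⨅ a : A, comap (fun T => T * (a : H →L[ℂ] H)) (𝓝 (m * (a : H →L[ℂ] H))) ⊓
      comap (fun T => (a : H →L[ℂ] H) * T) (𝓝 ((a : H →L[ℂ] H) * m)) := by
  rw [strictTopology, nhds_iInf]
  refine iInf_congr fun a => ?_
  exact nhds_inf.trans (congrArg₂ (· ⊓ ·) (nhds_induced _ _) (nhds_induced _ _))

theorem tendsto_strictFilter {f : ι → A} {l : Filter ι} {m : H →L[ℂ] H}
    (hf : StrictTendsto A (fun i => (f i : H →L[ℂ] H)) l m) (hb : ∀ᶠ i in l, ‖f i‖ ≤ ‖m‖) :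
    Tendsto f l (strictFilter A m) := by
  refine tendsto_inf.2 ⟨tendsto_comap_iff.2 ?_, tendsto_principal.2 hb⟩
  simp only [nhds_strictTopology, tendsto_iInf, tendsto_inf, tendsto_comap_iff]
  exact fun a => ⟨hf.mul_right a a.2, hf.mul_left a a.2⟩

theorem strictTendsto_strictFilter (m : H →L[ℂ] H) :
    StrictTendsto A (fun a : A => (a : H →L[ℂ] H)) (strictFilter A m) m where
  bdd := ⟨‖m‖, mem_inf_of_right fun _ h => h⟩
  mul_right a ha := by
    have h : Tendsto (fun a : A => (a : H →L[ℂ] H)) (strictFilter A m)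
        (@nhds _ (strictTopology A) m) := tendsto_iff_comap.2 inf_le_left
    simp only [nhds_strictTopology, tendsto_iInf, tendsto_inf, tendsto_comap_iff] at h
    exact (h ⟨a, ha⟩).1
  mul_left a ha := by
    have h : Tendsto (fun a : A => (a : H →L[ℂ] H)) (strictFilter A m)
        (@nhds _ (strictTopology A) m) := tendsto_iff_comap.2 inf_le_left
    simp only [nhds_strictTopology, tendsto_iInf, tendsto_inf, tendsto_comap_iff] at h
    exact (h ⟨a, ha⟩).2

theorem StrictTendsto.mulLeft_approximateUnit {l : Filter A}
    (hl : StrictTendsto A (fun e : A => (e : H →L[ℂ] H)) l 1) (m : multiplier A) :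
    StrictTendsto A (fun e : A => (mulLeft m e : H →L[ℂ] H)) l m := by
  simpa [mulLeft] using! (StrictTendsto.const (l := l) (m : H →L[ℂ] H)).mul hl m.2 (one_mem _)

theorem norm_mulLeft_le (m : multiplier A) (a : A) : ‖mulLeft m a‖ ≤ ‖(m : H →L[ℂ] H)‖ * ‖a‖ :=
  norm_mul_le (m : H →L[ℂ] H) (a : H →L[ℂ] H)

/-- The products m e, with e in a contractive approximate unit, converge strictly to m and stay in
the ball of radius ‖m‖. -/
theorem strictFilter_neBot (hA : IsClosed (A : Set (H →L[ℂ] H))) {m : H →L[ℂ] H}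
    (hm : m ∈ multiplier A) : (strictFilter A m).NeBot := by
  obtain ⟨l, hl, hb, hl1⟩ := exists_approximateUnit hA
  refine (tendsto_strictFilter (hl1.mulLeft_approximateUnit ⟨m, hm⟩) ?_).neBot
  filter_upwards [hb] with e he
  exact (norm_mulLeft_le _ _).trans (mul_le_of_le_one_right (norm_nonneg _) he)

/-! ### Strict extensions of positive functionals -/

variable {ω : StrongDual ℂ A}

theorem IsPositiveFunctional.cauchySchwarz (hA : IsClosed (A : Set (H →L[ℂ] H)))
    (hω : IsPositiveFunctional ω) (a b : A) :
    ‖ω (star a * b)‖ ^ 2 ≤ ‖ω (star a * a)‖ * ‖ω (star b * b)‖ := by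
  let _ : NonUnitalCStarAlgebra A := NonUnitalStarSubalgebra.nonUnitalCStarAlgebra A (h_closed := hA)
  exact positiveFunctional_cauchySchwarz (A := A) hω a b

theorem IsPositiveFunctional.exists_sub_mul_left_le (hA : IsClosed (A : Set (H →L[ℂ] H)))
    (hω : IsPositiveFunctional ω) {ε : ℝ} (hε : 0 < ε) :
    ∃ e : A, ∀ a, ‖ω a - ω (e * a)‖ ≤ ε * ‖a‖ := by
  let _ : NonUnitalCStarAlgebra A := NonUnitalStarSubalgebra.nonUnitalCStarAlgebra A (h_closed := hA)
  exact exists_positiveFunctional_sub_mul_left_le (A := A) hω hε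

/-- The difference f - g is bounded and strictly null. Up to a uniformly small error ω may be
replaced by ω(e ·), and e (f - g) tends to 0 in norm. Applied to one filter twice this gives the
Cauchy property; applied to two, independence of the approximating family. -/
theorem IsPositiveFunctional.tendsto_sub (hA : IsClosed (A : Set (H →L[ℂ] H)))
    (hω : IsPositiveFunctional ω) {f : ι → A} {g : ι' → A} {l : Filter ι} {l' : Filter ι'}
    {m : H →L[ℂ] H}
    (hf : StrictTendsto A (fun i => (f i : H →L[ℂ] H)) l m)
    (hg : StrictTendsto A (fun i => (g i : H →L[ℂ] H)) l' m) :
    Tendsto (fun p : ι × ι' => ω (f p.1) - ω (g p.2)) (l ×ˢ l') (𝓝 0) := by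
  have h := (hf.comp tendsto_fst).sub (hg.comp (tendsto_snd (f := l)))
  rw [sub_self] at h
  obtain ⟨C, hC⟩ := h.bdd
  rw [Metric.tendsto_nhds]
  intro ε hε
  obtain ⟨e, he⟩ := hω.exists_sub_mul_left_le hA (ε := ε / 2 / (|C| + 1)) (by positivity)
  have h0 : Tendsto (fun p : ι × ι' => ω (e * (f p.1 - g p.2))) (l ×ˢ l') (𝓝 0) := by
    have : Tendsto (fun p : ι × ι' => e * (f p.1 - g p.2)) (l ×ˢ l') (𝓝 0) :=
      tendsto_subtype_rng.2 (by simpa using h.mul_left e e.2)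
    simpa [Function.comp_def] using (ω.continuous.tendsto 0).comp this
  filter_upwards [hC, Metric.tendsto_nhds.1 h0 (ε / 2) (half_pos hε)] with p hp hp'
  rw [dist_zero_right] at hp' ⊢
  rw [← map_sub]
  have h1 := he (f p.1 - g p.2)
  have h2 : ε / 2 / (|C| + 1) * ‖f p.1 - g p.2‖ ≤ ε / 2 := by
    rw [div_mul_eq_mul_div, div_le_iff₀ (by positivity)]
    have : ‖f p.1 - g p.2‖ ≤ |C| + 1 := (hp.trans (le_abs_self C)).trans (by linarith)
    gcongr
  have h3 := norm_sub_norm_le (ω (f p.1 - g p.2)) (ω (e * (f p.1 - g p.2)))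
  linarith

theorem IsPositiveFunctional.tendsto_strictFilter (hA : IsClosed (A : Set (H →L[ℂ] H)))
    (hω : IsPositiveFunctional ω) {m : H →L[ℂ] H} (hm : m ∈ multiplier A) :
    Tendsto ω (strictFilter A m) (𝓝 (strictExt ω m)) := by
  have := strictFilter_neBot hA hm
  have hc : Cauchy (map ω (strictFilter A m)) := by
    rw [cauchy_map_iff]
    refine ⟨this, ?_⟩
    rw [uniformity_eq_comap_nhds_zero_swapped, tendsto_comap_iff]
    exact hω.tendsto_sub hA (f := id) (g := id) (strictTendsto_strictFilter m)
      (strictTendsto_strictFilter m)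
  exact tendsto_nhds_limUnder (CompleteSpace.complete hc)

/-- Strict continuity of positive functionals on bounded sets. -/
theorem IsPositiveFunctional.tendsto (hA : IsClosed (A : Set (H →L[ℂ] H)))
    (hω : IsPositiveFunctional ω) {f : ι → A} {l : Filter ι} {m : H →L[ℂ] H}
    (hm : m ∈ multiplier A) (hf : StrictTendsto A (fun i => (f i : H →L[ℂ] H)) l m) :
    Tendsto (fun i => ω (f i)) l (𝓝 (strictExt ω m)) := by
  have := strictFilter_neBot hA hm
  have h := (hω.tendsto_sub hA hf (g := id) (strictTendsto_strictFilter m)).add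
    ((hω.tendsto_strictFilter hA hm).comp (tendsto_snd (f := l)))
  have h' : Tendsto ((fun i => ω (f i)) ∘ Prod.fst) (l ×ˢ strictFilter A m)
      (𝓝 (strictExt ω m)) := by
    simpa [Function.comp_def] using h
  rwa [← tendsto_map'_iff, map_fst_prod] at h'

theorem IsPositiveFunctional.strictExt_coe (hA : IsClosed (A : Set (H →L[ℂ] H)))
    (hω : IsPositiveFunctional ω) (a : A) : strictExt ω (a : H →L[ℂ] H) = ω a :=
  tendsto_nhds_unique
    (hω.tendsto hA (coe_mem_multiplier a) (f := fun _ : ℕ => a) (l := atTop) (.const _))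
    tendsto_const_nhds

theorem IsPositiveFunctional.strictExt_sub (hA : IsClosed (A : Set (H →L[ℂ] H)))
    (hω : IsPositiveFunctional ω) {m n : H →L[ℂ] H} (hm : m ∈ multiplier A)
    (hn : n ∈ multiplier A) : strictExt ω (m - n) = strictExt ω m - strictExt ω n := by
  obtain ⟨l, hl, -, hl1⟩ := exists_approximateUnit hA
  have h1 := hl1.mulLeft_approximateUnit ⟨m, hm⟩
  have h2 := hl1.mulLeft_approximateUnit ⟨n, hn⟩
  have h3 := (hω.tendsto hA hm h1).sub (hω.tendsto hA hn h2)
  simp only [← map_sub] at h3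
  exact tendsto_nhds_unique (hω.tendsto hA (sub_mem hm hn) (h1.sub h2)) h3

theorem IsPositiveFunctional.norm_strictExt_le (hA : IsClosed (A : Set (H →L[ℂ] H)))
    (hω : IsPositiveFunctional ω) {m : H →L[ℂ] H} (hm : m ∈ multiplier A) :
    ‖strictExt ω m‖ ≤ ‖ω‖ * ‖m‖ := by
  obtain ⟨l, hl, hb, hl1⟩ := exists_approximateUnit hA
  refine le_of_tendsto (hω.tendsto hA hm (hl1.mulLeft_approximateUnit ⟨m, hm⟩)).norm ?_
  filter_upwards [hb] with e he
  refine (ω.le_opNorm _).trans (mul_le_mul_of_nonneg_left ?_ (norm_nonneg _))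
  exact (norm_mulLeft_le _ _).trans (mul_le_of_le_one_right (norm_nonneg _) he)

theorem IsPositiveFunctional.strictExt_cauchySchwarz (hA : IsClosed (A : Set (H →L[ℂ] H)))
    (hω : IsPositiveFunctional ω) {m n : H →L[ℂ] H} (hm : m ∈ multiplier A)
    (hn : n ∈ multiplier A) :
    ‖strictExt ω (star m * n)‖ ^ 2 ≤ ‖strictExt ω (star m * m)‖ * ‖strictExt ω (star n * n)‖ := by
  obtain ⟨l, hl, -, hl1⟩ := exists_approximateUnit hA
  have key : ∀ x y : multiplier A, Tendsto (fun e => ω (star (mulLeft x e) * mulLeft y e)) l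
      (𝓝 (strictExt ω (star (x : H →L[ℂ] H) * y))) := fun x y =>
    hω.tendsto hA (mul_mem (star_mem x.2) y.2)
      ((hl1.mulLeft_approximateUnit x).star.mul (hl1.mulLeft_approximateUnit y) (star_mem x.2) y.2)
  exact le_of_tendsto_of_tendsto' ((key ⟨m, hm⟩ ⟨n, hn⟩).norm.pow 2)
    ((key ⟨m, hm⟩ ⟨m, hm⟩).norm.mul (key ⟨n, hn⟩ ⟨n, hn⟩).norm)
    fun e => hω.cauchySchwarz hA _ _

/-- In the Cauchy–Schwarz bound for ω(m n) the factor ω(n* n) vanishes. With the adjoint version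
below, this is what allows null elements to be discarded on either side. -/
theorem IsPositiveFunctional.strictExt_mul_eq_zero (hA : IsClosed (A : Set (H →L[ℂ] H)))
    (hω : IsPositiveFunctional ω) {m n : H →L[ℂ] H} (hm : m ∈ multiplier A)
    (hn : n ∈ nullSpace ω) : strictExt ω (m * n) = 0 := by
  have h := hω.strictExt_cauchySchwarz hA (star_mem hm) hn.1
  rw [hn.2, norm_zero, mul_zero, star_star] at h
  simpa using le_antisymm h (by positivity)

theorem IsPositiveFunctional.strictExt_star_mul_eq_zero (hA : IsClosed (A : Set (H →L[ℂ] H)))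
    (hω : IsPositiveFunctional ω) {m n : H →L[ℂ] H} (hm : m ∈ multiplier A)
    (hn : n ∈ nullSpace ω) : strictExt ω (star n * m) = 0 := by
  have h := hω.strictExt_cauchySchwarz hA hn.1 hm
  rw [hn.2, norm_zero, zero_mul] at h
  simpa using le_antisymm h (by positivity)

/-- Strict continuity of the strict extension on bounded sets of multipliers. -/
theorem IsPositiveFunctional.tendsto_strictExt (hA : IsClosed (A : Set (H →L[ℂ] H)))
    (hω : IsPositiveFunctional ω) {f : ι → (H →L[ℂ] H)} {l : Filter ι} {m : H →L[ℂ] H}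
    (hfm : ∀ i, f i ∈ multiplier A) (hm : m ∈ multiplier A) (hf : StrictTendsto A f l m) :
    Tendsto (fun i => strictExt ω (f i)) l (𝓝 (strictExt ω m)) := by
  -- The approximation of ω by ω(e ·) passes to multipliers x by applying it to x d and letting d
  -- tend strictly to 1. Since e x lies in `A`, the approximant needs no extension.
  have key : ∀ {ε : ℝ}, 0 < ε → ∃ e : A, ∀ x : multiplier A,
      ‖strictExt ω (x : H →L[ℂ] H) - ω (mulRight x e)‖ ≤ ε * ‖(x : H →L[ℂ] H)‖ := by
    intro ε hε
    obtain ⟨e, he⟩ := hω.exists_sub_mul_left_le hA hε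
    refine ⟨e, fun x => ?_⟩
    obtain ⟨l, hl, hb, hl1⟩ := exists_approximateUnit hA
    have h1 := hω.tendsto hA x.2 (hl1.mulLeft_approximateUnit x)
    have h2 : Tendsto (fun d : A => e * mulLeft x d) l (𝓝 (mulRight x e)) :=
      tendsto_subtype_rng.2 ((hl1.mulLeft_approximateUnit x).mul_left e e.2)
    refine le_of_tendsto (h1.sub ((ω.continuous.tendsto _).comp h2)).norm ?_
    filter_upwards [hb] with d hd
    refine (he _).trans (mul_le_mul_of_nonneg_left ?_ hε.le)
    exact (norm_mulLeft_le _ _).trans (mul_le_of_le_one_right (norm_nonneg _) hd)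
  have h := hf.sub (.const m)
  rw [sub_self] at h
  obtain ⟨C, hC⟩ := h.bdd
  rw [Metric.tendsto_nhds]
  intro ε hε
  obtain ⟨e, he⟩ := key (ε := ε / 2 / (|C| + 1)) (by positivity)
  have h0 : Tendsto (fun i => ω (mulRight ⟨f i - m, sub_mem (hfm i) hm⟩ e)) l (𝓝 0) := by
    have : Tendsto (fun i => mulRight ⟨f i - m, sub_mem (hfm i) hm⟩ e) l (𝓝 0) :=
      tendsto_subtype_rng.2 (by simpa using! h.mul_left e e.2)
    simpa [Function.comp_def] using (ω.continuous.tendsto 0).comp this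
  filter_upwards [hC, Metric.tendsto_nhds.1 h0 (ε / 2) (half_pos hε)] with i hi hi'
  rw [dist_zero_right] at hi'
  rw [dist_eq_norm, ← hω.strictExt_sub hA (hfm i) hm]
  have h1 := he ⟨f i - m, sub_mem (hfm i) hm⟩
  simp only at h1
  have h2 : ε / 2 / (|C| + 1) * ‖f i - m‖ ≤ ε / 2 := by
    rw [div_mul_eq_mul_div, div_le_iff₀ (by positivity)]
    have : ‖f i - m‖ ≤ |C| + 1 := (hi.trans (le_abs_self C)).trans (by linarith)
    gcongr
  have h3 := norm_sub_norm_le (strictExt ω (f i - m))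
    (ω (mulRight ⟨f i - m, sub_mem (hfm i) hm⟩ e))
  linarith

/-- The strict extension of `x ↦ ω (p x q)`. -/
theorem IsPositiveFunctional.strictExt_leftAct_rightAct (hA : IsClosed (A : Set (H →L[ℂ] H)))
    (hω : IsPositiveFunctional ω) (p q : multiplier A) {m : H →L[ℂ] H} (hm : m ∈ multiplier A) :
    strictExt (leftAct q (rightAct ω p)) m = strictExt ω ((p : H →L[ℂ] H) * m * q) := by
  have := strictFilter_neBot hA hm
  refine Tendsto.limUnder_eq ?_
  have h := ((StrictTendsto.const (p : H →L[ℂ] H)).mul (strictTendsto_strictFilter m)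
    p.2 hm).mul (.const (q : H →L[ℂ] H)) (mul_mem p.2 hm) q.2
  refine hω.tendsto hA (f := fun x => mulLeft p (mulRight q x)) (mul_mem (mul_mem p.2 hm) q.2) ?_
  simpa [mulLeft, mulRight, mul_assoc] using! h

/-- Cauchy–Schwarz against 1 gives |ω(a)|² ≤ |ω(1)| ‖ω‖ ‖a‖², so ‖ω‖² ≤ |ω(1)| ‖ω‖. -/
theorem IsPositiveFunctional.norm_le_norm_strictExt_one (hA : IsClosed (A : Set (H →L[ℂ] H)))
    (hω : IsPositiveFunctional ω) : ‖ω‖ ≤ ‖strictExt ω 1‖ := by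
  have h : ‖ω‖ ≤ √(‖strictExt ω 1‖ * ‖ω‖) := by
    refine ω.opNorm_le_bound (Real.sqrt_nonneg _) fun a => ?_
    refine le_of_sq_le_sq ?_ (by positivity)
    rw [mul_pow, Real.sq_sqrt (by positivity), mul_assoc]
    have h := hω.strictExt_cauchySchwarz hA (one_mem (multiplier A)) (coe_mem_multiplier a)
    rw [star_one, one_mul, one_mul, hω.strictExt_coe hA] at h
    refine h.trans (mul_le_mul_of_nonneg_left ?_ (norm_nonneg _))
    refine (hω.norm_strictExt_le hA (coe_mem_multiplier (star a * a))).trans ?_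
    rw [sq]
    exact mul_le_mul_of_nonneg_left (CStarRing.norm_star_mul_self (x := (a : H →L[ℂ] H))).le
      (norm_nonneg ω)
  rcases (norm_nonneg ω).eq_or_lt with h0 | h0
  · rw [← h0]; positivity
  · rw [Real.le_sqrt h0.le (by positivity), sq] at h
    exact le_of_mul_le_mul_right h h0

end StrictConvergence

/-! ### Bilinearity and continuity of the tensor product of operators -/

section TensorOperators

attribute [local irreducible] tensorOp

variable {H K : Type*} [NormedAddCommGroup H] [InnerProductSpace ℂ H]
  [NormedAddCommGroup K] [InnerProductSpace ℂ K]

theorem norm_tensorOp_le (S : H →L[ℂ] H) (T : K →L[ℂ] K) : ‖tensorOp S T‖ ≤ ‖S‖ * ‖T‖ := by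
  refine ContinuousLinearMap.opNorm_le_bound _ (by positivity) fun x => ?_
  refine denseRange_ofAlg.induction_on x (isClosed_le (ContinuousLinearMap.continuous _).norm
    (continuous_const.mul continuous_norm)) fun x => ?_
  rw [tensorOp_ofAlg, LinearIsometry.norm_map, LinearIsometry.norm_map]
  exact (TensorProduct.mapL S T).le_of_opNorm_le (TensorProduct.norm_mapL_le S T) x

theorem tensorOp_add_left (S S' : H →L[ℂ] H) (T : K →L[ℂ] K) :
    tensorOp (S + S') T = tensorOp S T + tensorOp S' T := by
  ext x
  refine denseRange_ofAlg.induction_on x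
    (isClosed_eq (ContinuousLinearMap.continuous _) (ContinuousLinearMap.continuous _)) fun x => ?_
  simp only [add_apply, tensorOp_ofAlg, TensorProduct.mapL_add_left, map_add]

theorem tensorOp_add_right (S : H →L[ℂ] H) (T T' : K →L[ℂ] K) :
    tensorOp S (T + T') = tensorOp S T + tensorOp S T' := by
  ext x
  refine denseRange_ofAlg.induction_on x
    (isClosed_eq (ContinuousLinearMap.continuous _) (ContinuousLinearMap.continuous _)) fun x => ?_
  simp only [add_apply, tensorOp_ofAlg, TensorProduct.mapL_add_right, map_add]

theorem tensorOp_smul_left (c : ℂ) (S : H →L[ℂ] H) (T : K →L[ℂ] K) :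
    tensorOp (c • S) T = c • tensorOp S T := by
  ext x
  refine denseRange_ofAlg.induction_on x
    (isClosed_eq (ContinuousLinearMap.continuous _) (ContinuousLinearMap.continuous _)) fun x => ?_
  simp only [smul_apply, tensorOp_ofAlg, TensorProduct.mapL_smul_left,
    map_smul]

theorem tensorOp_smul_right (c : ℂ) (S : H →L[ℂ] H) (T : K →L[ℂ] K) :
    tensorOp S (c • T) = c • tensorOp S T := by
  ext x
  refine denseRange_ofAlg.induction_on x
    (isClosed_eq (ContinuousLinearMap.continuous _) (ContinuousLinearMap.continuous _)) fun x => ?_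
  simp only [smul_apply, tensorOp_ofAlg, TensorProduct.mapL_smul_right,
    map_smul]

theorem isBoundedBilinearMap_tensorOp : IsBoundedBilinearMap ℂ
    fun p : (H →L[ℂ] H) × (K →L[ℂ] K) => tensorOp p.1 p.2 where
  add_left := tensorOp_add_left
  smul_left := tensorOp_smul_left
  add_right := tensorOp_add_right
  smul_right := tensorOp_smul_right
  bound := ⟨1, one_pos, fun S T => by simpa using norm_tensorOp_le S T⟩

theorem continuous_tensorOp :
    Continuous fun p : (H →L[ℂ] H) × (K →L[ℂ] K) => tensorOp p.1 p.2 :=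
  isBoundedBilinearMap_tensorOp.continuous

theorem tendsto_tensorOp {ι : Type*} {l : Filter ι} {f : ι → (H →L[ℂ] H)} {g : ι → (K →L[ℂ] K)}
    {S : H →L[ℂ] H} {T : K →L[ℂ] K} (hf : Tendsto f l (𝓝 S)) (hg : Tendsto g l (𝓝 T)) :
    Tendsto (fun i => tensorOp (f i) (g i)) l (𝓝 (tensorOp S T)) := by
  have h : Tendsto (fun i => (f i, g i)) l (𝓝 (S, T)) := hf.prodMk_nhds hg
  simpa only [Function.comp_def] using (continuous_tensorOp.tendsto (S, T)).comp h

theorem norm_tmul (ξ : H) (η : K) : ‖tmul ξ η‖ = ‖ξ‖ * ‖η‖ := by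
  rw [tmul, LinearIsometry.norm_map, TensorProduct.norm_tmul]

theorem inner_tmul (ξ ξ' : H) (η η' : K) :
    inner ℂ (tmul ξ η) (tmul ξ' η') = inner ℂ ξ ξ' * inner ℂ η η' := by
  rw [tmul, tmul, LinearIsometry.inner_map_map, TensorProduct.inner_tmul]

theorem norm_le_of_forall_inner_le {T : H →L[ℂ] H} {C : ℝ} (hC : 0 ≤ C)
    (h : ∀ x y, ‖inner ℂ x (T y)‖ ≤ C * ‖x‖ * ‖y‖) : ‖T‖ ≤ C := by
  refine T.opNorm_le_bound hC fun y => ?_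
  rcases (norm_nonneg (T y)).eq_or_lt with h0 | h0
  · rw [← h0]; positivity
  · have := h (T y) y
    rw [inner_self_eq_norm_sq_to_K, norm_pow, RCLike.norm_ofReal, abs_norm, sq] at this
    exact le_of_mul_le_mul_left (by linarith) h0

end TensorOperators

/-! ### Functionals determined on a dense range -/

section DenseRange

variable {E H : Type*} [NormedAddCommGroup H] [InnerProductSpace ℂ H] [CompleteSpace H]
  {A : NonUnitalStarSubalgebra ℂ (H →L[ℂ] H)}

theorem exists_extension_of_norm_le [AddCommMonoid E] [Module ℂ E] {f : E →ₗ[ℂ] ℂ}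
    {e : E →ₗ[ℂ] A} (he : DenseRange e) {C : ℝ} (h : ∀ x, ‖f x‖ ≤ C * ‖e x‖) :
    ∃ g : StrongDual ℂ A, ∀ x, g (e x) = f x := by
  let _ : AddCommGroup E := Module.addCommMonoidToAddCommGroup ℂ
  exact ⟨f.extendOfNorm e, LinearMap.extendOfNorm_eq he ⟨C, h⟩⟩

theorem isPositiveFunctional_of_denseRange {e : E → A} (he : DenseRange e) {ω : StrongDual ℂ A}
    (h : ∀ x, 0 ≤ ω (star (e x) * e x)) : IsPositiveFunctional ω := by
  have hc : Continuous fun x : A => star x * x :=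
    continuous_induced_rng.2 ((continuous_star.comp continuous_subtype_val).mul continuous_subtype_val)
  exact fun x => he.induction_on x (isClosed_le continuous_const (ω.continuous.comp hc)) h

theorem apply_star_sum_mul_sum (ω : StrongDual ℂ A) {ι : Type*} [Fintype ι] (x : ι → A) :
    ω (star (∑ i, x i) * ∑ i, x i) = ∑ i, ∑ j, ω (star (x i) * x j) := by
  rw [star_sum, Finset.sum_mul_sum, map_sum]
  exact Finset.sum_congr rfl fun i _ => map_sum _ _ _

end DenseRange

/-! ### Product functionals on the spatial tensor product -/

section ProductFunctionals

attribute [local irreducible] tensorOp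

variable {H K ι : Type*} [NormedAddCommGroup H] [InnerProductSpace ℂ H] [CompleteSpace H]
  [NormedAddCommGroup K] [InnerProductSpace ℂ K] [CompleteSpace K]
  {A : NonUnitalStarSubalgebra ℂ (H →L[ℂ] H)} {B : NonUnitalStarSubalgebra ℂ (K →L[ℂ] K)}

theorem isClosed_minTensor : IsClosed (minTensor A B : Set (HTensor H K →L[ℂ] HTensor H K)) :=
  isClosed_closure

/-- The canonical map from the algebraic to the spatial tensor product. -/
def algToMin (A : NonUnitalStarSubalgebra ℂ (H →L[ℂ] H))
    (B : NonUnitalStarSubalgebra ℂ (K →L[ℂ] K)) : A ⊗[ℂ] B →ₗ[ℂ] minTensor A B :=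
  TensorProduct.lift <| LinearMap.mk₂ ℂ elemTensor
    (fun _ _ _ => Subtype.ext (tensorOp_add_left _ _ _))
    (fun _ _ _ => Subtype.ext (tensorOp_smul_left _ _ _))
    (fun _ _ _ => Subtype.ext (tensorOp_add_right _ _ _))
    (fun _ _ _ => Subtype.ext (tensorOp_smul_right _ _ _))

theorem algToMin_tmul (a : A) (b : B) : algToMin A B (a ⊗ₜ b) = elemTensor a b :=
  TensorProduct.lift.tmul _ _

theorem denseRange_algToMin : DenseRange (algToMin A B) := by
  intro x
  rw [closure_subtype]
  have hx : (x : HTensor H K →L[ℂ] HTensor H K) ∈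
    closure (Submodule.span ℂ (elemTensors A B) : Set (HTensor H K →L[ℂ] HTensor H K)) := x.2
  refine closure_mono (fun T hT => ?_) hx
  induction hT using Submodule.span_induction with
  | mem y hy =>
    obtain ⟨a, ha, b, hb, rfl⟩ := hy
    exact ⟨_, ⟨(⟨a, ha⟩ : A) ⊗ₜ (⟨b, hb⟩ : B), rfl⟩, by rw [algToMin_tmul]; rfl⟩
  | zero => exact ⟨_, ⟨0, rfl⟩, by simp⟩
  | add y z _ _ hy hz =>
    obtain ⟨_, ⟨s, rfl⟩, rfl⟩ := hy
    obtain ⟨_, ⟨t, rfl⟩, rfl⟩ := hz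
    exact ⟨_, ⟨s + t, rfl⟩, by simp⟩
  | smul c y _ hy =>
    obtain ⟨_, ⟨s, rfl⟩, rfl⟩ := hy
    exact ⟨_, ⟨c • s, rfl⟩, by simp⟩

/-- The algebraic slice `ω ⊗ id`. -/
def algSliceLeft (ω : StrongDual ℂ A) : A ⊗[ℂ] B →ₗ[ℂ] B :=
  TensorProduct.lift ((LinearMap.lsmul ℂ B).comp ω.toLinearMap)

/-- The algebraic slice by the vector functional `b ↦ ⟪η, b η'⟫`. -/
def algSliceVector (η η' : K) : A ⊗[ℂ] B →ₗ[ℂ] A :=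
  TensorProduct.lift (LinearMap.mk₂ ℂ
    (fun (a : A) (b : B) => (inner ℂ η ((b : K →L[ℂ] K) η') : ℂ) • a)
    (fun _ _ _ => smul_add _ _ _) (fun c a b => smul_comm _ c a)
    (fun a b b' => by
      rw [← add_smul, ← inner_add_right]; rfl)
    (fun c a b => by
      rw [smul_smul, ← smul_eq_mul, ← inner_smul_right_eq_smul]; rfl))

theorem inner_algSliceVector (ξ ξ' : H) (η η' : K) (t : A ⊗[ℂ] B) :
    inner ℂ ξ ((algSliceVector η η' t : H →L[ℂ] H) ξ') =
      inner ℂ (tmul ξ η) ((algToMin A B t : HTensor H K →L[ℂ] HTensor H K) (tmul ξ' η')) := by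
  induction t with
  | zero => simp
  | add s t hs ht =>
    simp only [map_add, NonUnitalStarSubalgebra.coe_add, add_apply,
      inner_add_right, hs, ht]
  | tmul a b =>
    rw [algToMin_tmul]
    change inner ℂ ξ (((inner ℂ η ((b : K →L[ℂ] K) η') : ℂ) • (a : H →L[ℂ] H)) ξ') =
      inner ℂ (tmul ξ η) (tensorOp (a : H →L[ℂ] H) (b : K →L[ℂ] K) (tmul ξ' η'))
    rw [tensorOp_tmul, inner_tmul, smul_apply, inner_smul_right, mul_comm]

theorem norm_algSliceVector_le (η η' : K) (t : A ⊗[ℂ] B) :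
    ‖algSliceVector η η' t‖ ≤ ‖algToMin A B t‖ * ‖η‖ * ‖η'‖ := by
  refine norm_le_of_forall_inner_le (by positivity) fun ξ ξ' => ?_
  change ‖inner ℂ ξ ((algSliceVector η η' t : H →L[ℂ] H) ξ')‖ ≤ _
  rw [inner_algSliceVector]
  refine (norm_inner_le_norm _ _).trans ?_
  have h := (algToMin A B t : HTensor H K →L[ℂ] HTensor H K).le_opNorm (tmul ξ' η')
  rw [norm_tmul] at h ⊢
  calc _ ≤ ‖ξ‖ * ‖η‖ * (‖algToMin A B t‖ * (‖ξ'‖ * ‖η'‖)) := by gcongr; exact h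
    _ = _ := by ring

theorem inner_algSliceLeft (ω : StrongDual ℂ A) (η η' : K) (t : A ⊗[ℂ] B) :
    inner ℂ η ((algSliceLeft ω t : K →L[ℂ] K) η') = ω (algSliceVector η η' t) := by
  induction t with
  | zero => simp
  | add s t hs ht =>
    simp only [map_add, NonUnitalStarSubalgebra.coe_add, add_apply,
      inner_add_right, hs, ht]
  | tmul a b =>
    change inner ℂ η ((ω a • (b : K →L[ℂ] K)) η') =
      ω ((inner ℂ η ((b : K →L[ℂ] K) η') : ℂ) • a)
    rw [smul_apply, inner_smul_right, map_smul, smul_eq_mul, mul_comm]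

/-- A matrix coefficient of (ω ⊗ id)(t) is ω applied to a slice of t by a vector functional, and
vector slices are bounded by the operator norm on the Hilbert space tensor product. This bound makes
ω ⊗ μ extend from the algebraic to the spatial tensor product. -/
theorem norm_algSliceLeft_le (ω : StrongDual ℂ A) (t : A ⊗[ℂ] B) :
    ‖algSliceLeft ω t‖ ≤ ‖ω‖ * ‖algToMin A B t‖ := by
  refine norm_le_of_forall_inner_le (by positivity) fun η η' => ?_
  change ‖inner ℂ η ((algSliceLeft ω t : K →L[ℂ] K) η')‖ ≤ _
  rw [inner_algSliceLeft]
  refine (ω.le_opNorm _).trans ?_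
  calc _ ≤ ‖ω‖ * (‖algToMin A B t‖ * ‖η‖ * ‖η'‖) := by gcongr; exact norm_algSliceVector_le _ _ _
    _ = _ := by ring

theorem tensorFunctional_elemTensor (ω : StrongDual ℂ A) (μ : StrongDual ℂ B) (a : A) (b : B) :
    tensorFunctional ω μ (elemTensor a b) = ω a * μ b := by
  have hbound : ∀ t : A ⊗[ℂ] B, ‖(μ.toLinearMap ∘ₗ algSliceLeft ω) t‖ ≤
      ‖μ‖ * ‖ω‖ * ‖algToMin A B t‖ := fun t => by
    rw [mul_assoc]
    exact (μ.le_opNorm _).trans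
      (mul_le_mul_of_nonneg_left (norm_algSliceLeft_le ω t) (norm_nonneg _))
  have h : ∃ f : StrongDual ℂ (minTensor A B), ∀ (a : A) (b : B),
      f (elemTensor a b) = ω a * μ b := by
    obtain ⟨g, hg⟩ := exists_extension_of_norm_le denseRange_algToMin hbound
    refine ⟨g, fun a b => ?_⟩
    rw [← algToMin_tmul, hg]
    change μ (ω a • b) = _
    rw [map_smul, smul_eq_mul]
  exact Classical.epsilon_spec h a b

theorem minTensor_functional_ext {f g : StrongDual ℂ (minTensor A B)}
    (h : ∀ (a : A) (b : B), f (elemTensor a b) = g (elemTensor a b)) : f = g := by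
  ext x
  refine denseRange_algToMin.induction_on x (isClosed_eq f.continuous g.continuous) fun t => ?_
  induction t with
  | zero => simp
  | add s t hs ht => simp only [map_add, hs, ht]
  | tmul a b => rw [algToMin_tmul, h]

theorem posSemidef_of_isPositiveFunctional (hA : IsClosed (A : Set (H →L[ℂ] H)))
    {ω : StrongDual ℂ A} (hω : IsPositiveFunctional ω) {ι : Type*} [Fintype ι] (a : ι → A) :
    (Matrix.of fun i j => ω (star (a i) * a j)).PosSemidef := by
  let _ : NonUnitalCStarAlgebra A :=
    NonUnitalStarSubalgebra.nonUnitalCStarAlgebra A (h_closed := hA)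
  refine .of_dotProduct_mulVec_nonneg ?_ fun x => ?_
  · ext i j
    have := positiveFunctional_star (A := A) hω (star (a j) * a i)
    rw [star_mul, star_star] at this
    exact this.symm
  · have h := hω (∑ i, x i • a i)
    rw [star_sum, Finset.sum_mul_sum, map_sum] at h
    refine h.trans_eq ?_
    simp only [dotProduct, Matrix.mulVec, Matrix.of_apply, Finset.mul_sum, map_sum, star_smul,
      smul_mul_assoc, mul_smul_comm, map_smul, smul_eq_mul, Pi.star_apply]
    refine Finset.sum_congr rfl fun i _ => Finset.sum_congr rfl fun j _ => ?_
    ring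

theorem elemTensor_mul (a a' : A) (b b' : B) :
    elemTensor a b * elemTensor a' b' = elemTensor (a * a') (b * b') :=
  Subtype.ext (tensorOp_mul _ _ _ _)

theorem star_elemTensor (a : A) (b : B) :
    star (elemTensor a b) = elemTensor (star a) (star b) :=
  Subtype.ext (star_tensorOp _ _)

/-- For t = ∑ aᵢ ⊗ bᵢ, the value at t* t is the sum of the entries of the Hadamard product of the
matrices ω(aᵢ* aⱼ) and μ(bᵢ* bⱼ). Both are positive semidefinite, hence so is their Hadamard product
by Schur. -/
theorem IsPositiveFunctional.tensorFunctional (hA : IsClosed (A : Set (H →L[ℂ] H)))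
    (hB : IsClosed (B : Set (K →L[ℂ] K))) {ω : StrongDual ℂ A} {μ : StrongDual ℂ B}
    (hω : IsPositiveFunctional ω) (hμ : IsPositiveFunctional μ) :
    IsPositiveFunctional (tensorFunctional ω μ) := by
  refine isPositiveFunctional_of_denseRange denseRange_algToMin fun t => ?_
  obtain ⟨s, rfl⟩ := TensorProduct.exists_finset t
  have hM := (posSemidef_of_isPositiveFunctional hA hω fun i : s => i.1.1).hadamard
    (posSemidef_of_isPositiveFunctional hB hμ fun i : s => i.1.2)
  have h := hM.dotProduct_mulVec_nonneg 1
  refine h.trans_eq ?_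
  rw [← Finset.sum_coe_sort s, map_sum, apply_star_sum_mul_sum]
  simp only [algToMin_tmul, star_elemTensor, elemTensor_mul, tensorFunctional_elemTensor,
    dotProduct, Matrix.mulVec, Matrix.hadamard_apply, Matrix.of_apply, Pi.star_apply,
    Pi.one_apply, star_one, one_mul, mul_one]

/-! ### Multipliers of the spatial tensor product -/

theorem minTensor_le {S : Submodule ℂ (HTensor H K →L[ℂ] HTensor H K)}
    (hS : IsClosed (S : Set (HTensor H K →L[ℂ] HTensor H K)))
    (h : ∀ a ∈ A, ∀ b ∈ B, tensorOp a b ∈ S) {x : HTensor H K →L[ℂ] HTensor H K}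
    (hx : x ∈ minTensor A B) : x ∈ S := by
  refine (Submodule.topologicalClosure_minimal _ (Submodule.span_le.2 ?_) hS) hx
  rintro _ ⟨a, ha, b, hb, rfl⟩
  exact h a ha b hb

theorem tensorOp_mem_minTensor {a : H →L[ℂ] H} {b : K →L[ℂ] K} (ha : a ∈ A) (hb : b ∈ B) :
    tensorOp a b ∈ minTensor A B :=
  (elemTensor (⟨a, ha⟩ : A) (⟨b, hb⟩ : B)).2

theorem map_mem_minTensor
    {f : (HTensor H K →L[ℂ] HTensor H K) →L[ℂ] (HTensor H K →L[ℂ] HTensor H K)}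
    (h : ∀ a ∈ A, ∀ b ∈ B, f (tensorOp a b) ∈ minTensor A B) {x : HTensor H K →L[ℂ] HTensor H K}
    (hx : x ∈ minTensor A B) : f x ∈ minTensor A B := by
  refine isClosed_minTensor.closure_subset_iff.2 (fun y hy => ?_)
    (map_mem_closure (t := minTensor A B) f.continuous hx fun y hy => ?_)
  · exact hy
  · induction hy using Submodule.span_induction with
    | mem y hy =>
      obtain ⟨a, ha, b, hb, rfl⟩ := hy
      exact h a ha b hb
    | zero => rw [map_zero]; exact zero_mem _
    | add y z _ _ hy hz => rw [map_add]; exact add_mem hy hz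
    | smul c y _ hy => rw [map_smul]; exact SMulMemClass.smul_mem c hy

theorem tensorOp_mem_multiplier {m : H →L[ℂ] H} {n : K →L[ℂ] K} (hm : m ∈ multiplier A)
    (hn : n ∈ multiplier B) : tensorOp m n ∈ multiplier (minTensor A B) :=
  fun x hx => ⟨map_mem_minTensor (f := ContinuousLinearMap.mul ℂ _ (tensorOp m n))
    (fun a ha b hb => by
      rw [ContinuousLinearMap.mul_apply', tensorOp_mul]
      exact tensorOp_mem_minTensor (hm a ha).1 (hn b hb).1) hx,
    map_mem_minTensor (f := (ContinuousLinearMap.mul ℂ (HTensor H K →L[ℂ] HTensor H K)).flip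
      (tensorOp m n))
    (fun a ha b hb => by
      rw [ContinuousLinearMap.flip_apply, ContinuousLinearMap.mul_apply', tensorOp_mul]
      exact tensorOp_mem_minTensor (hm a ha).2 (hn b hb).2) hx⟩

/-- The closed subspace of operators `x` with `f i * x → m * x`, for bounded `f`. -/
def rightConvergenceSubmodule (f : ι → (H →L[ℂ] H)) (l : Filter ι) (m : H →L[ℂ] H) :
    Submodule ℂ (H →L[ℂ] H) where
  carrier := {x | Tendsto (fun i => f i * x) l (𝓝 (m * x))}
  add_mem' hx hy := by simpa only [Set.mem_ofPred_eq, mul_add] using hx.add hy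
  zero_mem' := by simp [tendsto_const_nhds]
  smul_mem' c x hx := by simpa only [Set.mem_ofPred_eq, mul_smul_comm] using hx.const_smul c

theorem isClosed_rightConvergenceSubmodule {f : ι → (H →L[ℂ] H)} {l : Filter ι} (m : H →L[ℂ] H)
    (hf : ∃ C, ∀ᶠ i in l, ‖f i‖ ≤ C) :
    IsClosed (rightConvergenceSubmodule f l m : Set (H →L[ℂ] H)) := by
  obtain ⟨C, hC⟩ := hf
  refine isClosed_of_closure_subset fun x hx => ?_
  change Tendsto (fun i => f i * x) l (𝓝 (m * x))
  rw [Metric.tendsto_nhds]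
  intro ε hε
  obtain ⟨y, hy, hxy⟩ := Metric.mem_closure_iff.1 hx (ε / 2 / (|C| + ‖m‖ + 1)) (by positivity)
  rw [dist_eq_norm, lt_div_iff₀ (by positivity)] at hxy
  filter_upwards [hC, Metric.tendsto_nhds.1 hy (ε / 2) (half_pos hε)] with i hi hi'
  rw [dist_eq_norm] at hi' ⊢
  have h1 : f i * x - m * x = f i * (x - y) - m * (x - y) + (f i * y - m * y) := by
    simp only [mul_sub]; abel
  have h2 : ‖f i * (x - y)‖ ≤ |C| * ‖x - y‖ :=
    (norm_mul_le _ _).trans (by gcongr; exact hi.trans (le_abs_self C))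
  have h3 := norm_mul_le m (x - y)
  rw [h1]
  have h4 := norm_add_le (f i * (x - y) - m * (x - y)) (f i * y - m * y)
  have h5 := norm_sub_le (f i * (x - y)) (m * (x - y))
  nlinarith [norm_nonneg (x - y)]

theorem StrictTendsto.of_right {f : ι → (H →L[ℂ] H)} {l : Filter ι} {m : H →L[ℂ] H}
    (hb : ∃ C, ∀ᶠ i in l, ‖f i‖ ≤ C) (h : ∀ a ∈ A, Tendsto (fun i => f i * a) l (𝓝 (m * a)))
    (h' : ∀ a ∈ A, Tendsto (fun i => Star.star (f i) * a) l (𝓝 (Star.star m * a))) :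
    StrictTendsto A f l m :=
  ⟨hb, h, fun a ha => by simpa using (h' _ (star_mem ha)).star⟩

/-- For a bounded family the operators on which convergence holds form a closed subspace, so
elementary tensors suffice. -/
theorem StrictTendsto.tensorOp {f : ι → (H →L[ℂ] H)} {g : ι → (K →L[ℂ] K)} {l : Filter ι}
    {m : H →L[ℂ] H} {n : K →L[ℂ] K} (hf : StrictTendsto A f l m) (hg : StrictTendsto B g l n) :
    StrictTendsto (minTensor A B) (fun i => tensorOp (f i) (g i)) l (tensorOp m n) := by
  have hb : ∃ C, ∀ᶠ i in l, ‖QG.tensorOp (f i) (g i)‖ ≤ C := by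
    obtain ⟨C, hC⟩ := hf.bdd
    obtain ⟨D, hD⟩ := hg.bdd
    refine ⟨C * D, ?_⟩
    filter_upwards [hC, hD] with i hi hi'
    exact (norm_tensorOp_le _ _).trans
      (mul_le_mul hi hi' (norm_nonneg _) ((norm_nonneg _).trans hi))
  refine .of_right hb (fun x hx => ?_) (fun x hx => ?_)
  · refine minTensor_le (isClosed_rightConvergenceSubmodule _ hb) (fun a ha b hb => ?_) hx
    change Tendsto (fun i => QG.tensorOp (f i) (g i) * QG.tensorOp a b) l
      (𝓝 (QG.tensorOp m n * QG.tensorOp a b))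
    simp only [tensorOp_mul]
    exact tendsto_tensorOp (hf.mul_right a ha) (hg.mul_right b hb)
  · refine minTensor_le (isClosed_rightConvergenceSubmodule (f := fun i => Star.star _) _
      (by simpa using hb)) (fun a ha b hb => ?_) hx
    change Tendsto (fun i => Star.star (QG.tensorOp (f i) (g i)) * QG.tensorOp a b) l
      (𝓝 (Star.star (QG.tensorOp m n) * QG.tensorOp a b))
    simp only [tensorOp_mul, star_tensorOp]
    exact tendsto_tensorOp (hf.star.mul_right a ha) (hg.star.mul_right b hb)

theorem IsPositiveFunctional.strictExt_tensorOp (hA : IsClosed (A : Set (H →L[ℂ] H)))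
    (hB : IsClosed (B : Set (K →L[ℂ] K))) {ω : StrongDual ℂ A} {μ : StrongDual ℂ B}
    (hω : IsPositiveFunctional ω) (hμ : IsPositiveFunctional μ) {m : H →L[ℂ] H} {n : K →L[ℂ] K}
    (hm : m ∈ multiplier A) (hn : n ∈ multiplier B) :
    strictExt (QG.tensorFunctional ω μ) (tensorOp m n) = strictExt ω m * strictExt μ n := by
  obtain ⟨l, hl, -, hl1⟩ := exists_approximateUnit hA
  obtain ⟨l', hl', -, hl1'⟩ := exists_approximateUnit hB
  have h1 := (hl1.mulLeft_approximateUnit ⟨m, hm⟩).comp (tendsto_fst (g := l'))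
  have h2 := (hl1'.mulLeft_approximateUnit ⟨n, hn⟩).comp (tendsto_snd (f := l))
  have h := (hω.tensorFunctional hA hB hμ).tendsto isClosed_minTensor
    (tensorOp_mem_multiplier hm hn) (f := fun p : A × B =>
      elemTensor (mulLeft ⟨m, hm⟩ p.1) (mulLeft ⟨n, hn⟩ p.2)) (h1.tensorOp h2)
  simp only [tensorFunctional_elemTensor] at h
  exact tendsto_nhds_unique h ((hω.tendsto hA hm h1).mul (hμ.tendsto hB hn h2))

end ProductFunctionals

/-! ### Extension of nondegenerate *-homomorphisms to multipliers -/

section NondegenerateHoms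

variable {H K ι : Type*} [NormedAddCommGroup H] [InnerProductSpace ℂ H] [CompleteSpace H]
  [NormedAddCommGroup K] [InnerProductSpace ℂ K] [CompleteSpace K]
  {A : NonUnitalStarSubalgebra ℂ (H →L[ℂ] H)} {D : NonUnitalStarSubalgebra ℂ (K →L[ℂ] K)}
  {Φ : A →⋆ₙₐ[ℂ] (K →L[ℂ] K)}

theorem norm_starHom_le (hA : IsClosed (A : Set (H →L[ℂ] H))) (Φ : A →⋆ₙₐ[ℂ] (K →L[ℂ] K)) (a : A) :
    ‖Φ a‖ ≤ ‖a‖ := by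
  let _ : NonUnitalCStarAlgebra A :=
    NonUnitalStarSubalgebra.nonUnitalCStarAlgebra A (h_closed := hA)
  exact NonUnitalStarAlgHom.norm_apply_le Φ a

theorem continuous_starHom (hA : IsClosed (A : Set (H →L[ℂ] H))) (Φ : A →⋆ₙₐ[ℂ] (K →L[ℂ] K)) :
    Continuous Φ :=
  AddMonoidHomClass.continuous_of_bound Φ 1 fun a => by simpa using norm_starHom_le hA Φ a

theorem exists_clm_of_norm_le {E : Type*} [AddCommMonoid E] [Module ℂ E] {f e : E →ₗ[ℂ] K}
    (he : DenseRange e) {C : ℝ} (h : ∀ x, ‖f x‖ ≤ C * ‖e x‖) :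
    ∃ g : K →L[ℂ] K, ∀ x, g (e x) = f x := by
  let _ : AddCommGroup E := Module.addCommMonoidToAddCommGroup ℂ
  exact ⟨f.extendOfNorm e, LinearMap.extendOfNorm_eq he ⟨C, h⟩⟩

/-- The map `a ⊗ ξ ↦ Φ(a) ξ`. -/
def evalTensor (Φ : A →⋆ₙₐ[ℂ] (K →L[ℂ] K)) : A ⊗[ℂ] K →ₗ[ℂ] K :=
  TensorProduct.lift (LinearMap.mk₂ ℂ (fun (a : A) (ξ : K) => Φ a ξ)
    (fun _ _ _ => by rw [map_add, add_apply])
    (fun _ _ _ => by rw [map_smul, smul_apply])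
    (fun _ _ _ => map_add _ _ _)
    (fun _ _ _ => map_smul _ _ _))

theorem evalTensor_tmul (a : A) (ξ : K) : evalTensor Φ (a ⊗ₜ ξ) = Φ a ξ :=
  TensorProduct.lift.tmul _ _

theorem denseRange_evalTensor (hΦ : Dense (Submodule.span ℂ {x : K | ∃ a ξ, x = Φ a ξ} : Set K)) :
    DenseRange (evalTensor Φ) := by
  refine hΦ.mono fun x hx => ?_
  have h : Submodule.span ℂ {x : K | ∃ a ξ, x = Φ a ξ} ≤ LinearMap.range (evalTensor Φ) := by
    refine Submodule.span_le.2 ?_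
    rintro _ ⟨a, ξ, rfl⟩
    exact ⟨a ⊗ₜ ξ, evalTensor_tmul a ξ⟩
  exact h hx

/-- The assignment Φ(a) ξ ↦ Φ(m a) ξ is, on the dense span, the pointwise limit of Φ(m d) along an
approximate unit d. It is therefore well defined and bounded by ‖m‖, so the operator that `homExt`
chooses exists. -/
theorem homExt_mul (hA : IsClosed (A : Set (H →L[ℂ] H)))
    (hΦ : Dense (Submodule.span ℂ {x : K | ∃ a ξ, x = Φ a ξ} : Set K)) (m : multiplier A) (a : A) :
    homExt Φ (m : H →L[ℂ] H) * Φ a = Φ (mulLeft m a) := by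
  let f : A ⊗[ℂ] K →ₗ[ℂ] K := evalTensor Φ ∘ₗ (mulLeft m).toLinearMap.rTensor K
  obtain ⟨l, hl, hb, hl1⟩ := exists_approximateUnit hA
  have hlim : ∀ t, Tendsto (fun d => Φ (mulLeft m d) (evalTensor Φ t)) l (𝓝 (f t)) := by
    intro t
    induction t with
    | zero => simp
    | add s t hs ht => simpa only [map_add] using hs.add ht
    | tmul a ξ =>
      have h1 : Tendsto (fun d : A => mulLeft m d * a) l (𝓝 (mulLeft m a)) :=
        tendsto_subtype_rng.2 ((hl1.mulLeft_approximateUnit m).mul_right a a.2)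
      have h2 := ((continuous_starHom hA Φ).tendsto _).comp h1
      have h3 := ((ContinuousLinearMap.apply ℂ K ξ).continuous.tendsto _).comp h2
      have h4 : f (a ⊗ₜ ξ) = Φ (mulLeft m a) ξ := evalTensor_tmul _ _
      rw [h4, evalTensor_tmul]
      refine h3.congr fun d => ?_
      simp
  have hbound : ∀ t, ‖f t‖ ≤ ‖(m : H →L[ℂ] H)‖ * ‖evalTensor Φ t‖ := by
    intro t
    refine le_of_tendsto (hlim t).norm ?_
    filter_upwards [hb] with d hd
    refine ((Φ (mulLeft m d)).le_opNorm _).trans (mul_le_mul_of_nonneg_right ?_ (norm_nonneg _))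
    refine (norm_starHom_le hA Φ _).trans ((norm_mulLeft_le _ _).trans ?_)
    exact mul_le_of_le_one_right (norm_nonneg _) hd
  obtain ⟨T, hT⟩ := exists_clm_of_norm_le (denseRange_evalTensor hΦ) hbound
  have h : ∃ T : K →L[ℂ] K, ∀ a b : A, (b : H →L[ℂ] H) = m * (a : H →L[ℂ] H) →
      T * Φ a = Φ b := by
    refine ⟨T, fun a b hab => ?_⟩
    obtain rfl : b = mulLeft m a := Subtype.ext hab
    ext ξ
    have := hT (a ⊗ₜ ξ)
    rw [evalTensor_tmul] at this
    exact this.trans (evalTensor_tmul _ _)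
  exact Classical.epsilon_spec h a _ rfl

theorem eq_of_mul_starHom_eq (hΦ : Dense (Submodule.span ℂ {x : K | ∃ a ξ, x = Φ a ξ} : Set K))
    {S T : K →L[ℂ] K} (h : ∀ a, S * Φ a = T * Φ a) : S = T := by
  refine ContinuousLinearMap.ext_on hΦ ?_
  rintro _ ⟨a, ξ, rfl⟩
  exact DFunLike.congr_fun (h a) ξ

theorem mul_homExt (hA : IsClosed (A : Set (H →L[ℂ] H)))
    (hΦ : Dense (Submodule.span ℂ {x : K | ∃ a ξ, x = Φ a ξ} : Set K)) (m : multiplier A) (a : A) :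
    Φ a * homExt Φ (m : H →L[ℂ] H) = Φ (mulRight m a) := by
  refine eq_of_mul_starHom_eq hΦ fun b => ?_
  rw [mul_assoc, homExt_mul hA hΦ, ← map_mul, ← map_mul]
  exact congrArg Φ (Subtype.ext (mul_assoc _ _ _).symm)

theorem homExt_one (hA : IsClosed (A : Set (H →L[ℂ] H)))
    (hΦ : Dense (Submodule.span ℂ {x : K | ∃ a ξ, x = Φ a ξ} : Set K)) :
    homExt Φ (1 : H →L[ℂ] H) = 1 := by
  refine eq_of_mul_starHom_eq hΦ fun a => ?_
  rw [one_mul]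
  refine (homExt_mul hA hΦ 1 a).trans (congrArg Φ (Subtype.ext (one_mul _)))

/-- On a product Φ(a) X convergence reduces to norm convergence of f a to a in `A`; such products
span a subspace whose closure contains `D`, and the Φ(f) are bounded. -/
theorem strictTendsto_starHom (hA : IsClosed (A : Set (H →L[ℂ] H)))
    (hD : (D : Set (K →L[ℂ] K)) ⊆
      closure (Submodule.span ℂ {T | ∃ a : A, ∃ X ∈ D, T = Φ a * X} : Set (K →L[ℂ] K)))
    {f : ι → A} {l : Filter ι} (hf : StrictTendsto A (fun i => (f i : H →L[ℂ] H)) l 1) :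
    StrictTendsto D (fun i => Φ (f i)) l 1 := by
  have key : ∀ {g : ι → A}, StrictTendsto A (fun i => (g i : H →L[ℂ] H)) l 1 →
      (∃ C, ∀ᶠ i in l, ‖Φ (g i)‖ ≤ C) ∧
      ∀ X ∈ D, Tendsto (fun i => Φ (g i) * X) l (𝓝 (1 * X)) := by
    intro g hg
    have hb : ∃ C, ∀ᶠ i in l, ‖Φ (g i)‖ ≤ C := by
      obtain ⟨C, hC⟩ := hg.bdd
      exact ⟨C, hC.mono fun i hi => (norm_starHom_le hA Φ _).trans hi⟩
    refine ⟨hb, fun X hX => ?_⟩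
    have hle : Submodule.span ℂ {T | ∃ a : A, ∃ X ∈ D, T = Φ a * X} ≤
        rightConvergenceSubmodule (fun i => Φ (g i)) l 1 := by
      refine Submodule.span_le.2 ?_
      rintro _ ⟨a, Y, -, rfl⟩
      change Tendsto (fun i => Φ (g i) * (Φ a * Y)) l (𝓝 (1 * (Φ a * Y)))
      simp only [← mul_assoc, ← map_mul, one_mul]
      have h1 : Tendsto (fun i => g i * a) l (𝓝 a) :=
        tendsto_subtype_rng.2 (by simpa using hg.mul_right a a.2)
      exact (((continuous_starHom hA Φ).tendsto _).comp h1).mul_const Y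
    exact (isClosed_rightConvergenceSubmodule 1 hb).closure_subset_iff.2 hle (hD hX)
  have hs : StrictTendsto A (fun i => ((star (f i) : A) : H →L[ℂ] H)) l 1 := by
    simpa using! hf.star
  refine .of_right (key hf).1 (key hf).2 ?_
  simpa only [← map_star, star_one] using (key hs).2

variable {W : StrongDual ℂ D}

/-- If `Φ(u) - w` and `Φ(v) - w'` are null for the positive functional `W`, then
`W(w'* Φ(a) w) = W(Φ(v* a u))`. -/
theorem strictExt_star_mul_starHom_mul (hA : IsClosed (A : Set (H →L[ℂ] H)))
    (hD : IsClosed (D : Set (K →L[ℂ] K)))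
    (hΦ : Dense (Submodule.span ℂ {x : K | ∃ a ξ, x = Φ a ξ} : Set K))
    (hΦD : ∀ a, Φ a ∈ multiplier D) (hW : IsPositiveFunctional W)
    {u v : multiplier A} {w w' : K →L[ℂ] K} (hw : w ∈ multiplier D) (hw' : w' ∈ multiplier D)
    (hu : homExt Φ (u : H →L[ℂ] H) - w ∈ nullSpace W)
    (hv : homExt Φ (v : H →L[ℂ] H) - w' ∈ nullSpace W) (a : A) :
    strictExt W (star w' * Φ a * w) = strictExt W (Φ (mulLeft (star v) (mulRight u a))) := by
  set S := homExt Φ (u : H →L[ℂ] H)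
  set T := homExt Φ (v : H →L[ℂ] H)
  have hT : T ∈ multiplier D := by simpa using add_mem hv.1 hw'
  have hS : S ∈ multiplier D := by simpa using add_mem hu.1 hw
  have h1 : Φ (mulLeft (star v) (mulRight u a)) = star T * Φ a * S := by
    rw [mul_assoc, mul_homExt hA hΦ]
    have : star T * Φ (mulRight u a) = star (Φ (star (mulRight u a)) * T) := by
      rw [star_mul, ← map_star, star_star]
    rw [this, mul_homExt hA hΦ, ← map_star]
    congr 1
    exact Subtype.ext (by simp [mulLeft, mulRight])
  have h2 := hW.strictExt_mul_eq_zero hD (mul_mem (star_mem hT) (hΦD a)) hu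
  have h3 := hW.strictExt_star_mul_eq_zero hD (mul_mem (hΦD a) hw) hv
  -- The last two terms contain the null elements S - w on the right and (T - w')* on the left, so W
  -- annihilates them.
  have h4 : star w' * Φ a * w =
      star T * Φ a * S - star T * Φ a * (S - w) - star (T - w') * (Φ a * w) := by
    rw [star_sub]; noncomm_ring
  rw [h4, hW.strictExt_sub hD, hW.strictExt_sub hD, h2, h3, sub_zero, sub_zero, h1]
  · exact mul_mem (mul_mem (star_mem hT) (hΦD a)) hS
  · exact mul_mem (mul_mem (star_mem hT) (hΦD a)) hu.1
  · exact sub_mem (mul_mem (mul_mem (star_mem hT) (hΦD a)) hS)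
      (mul_mem (mul_mem (star_mem hT) (hΦD a)) hu.1)
  · exact mul_mem (star_mem hv.1) (mul_mem (hΦD a) hw)

end NondegenerateHoms

/-! ### Norm, positivity and nonvanishing of u.σ.u*, u.σ and σ.u* -/

section CompressedStates

variable {H : Type*} [NormedAddCommGroup H] [InnerProductSpace ℂ H] [CompleteSpace H]
  {A : NonUnitalStarSubalgebra ℂ (H →L[ℂ] H)} {σ : StrongDual ℂ A} {u : multiplier A}

theorem tendsto_conjugate_approximateUnit (hA : IsClosed (A : Set (H →L[ℂ] H)))
    (hσ : IsPositiveFunctional σ) {l : Filter A}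
    (hl1 : StrictTendsto A (fun e : A => (e : H →L[ℂ] H)) l 1) :
    Tendsto (fun e => σ (mulLeft (star u) (mulRight u e))) l
      (𝓝 (strictExt σ (star (u : H →L[ℂ] H) * u))) := by
  refine hσ.tendsto hA (mul_mem (star_mem u.2) u.2) ?_
  have h := (StrictTendsto.const (star (u : H →L[ℂ] H))).mul
    (hl1.mul (.const (u : H →L[ℂ] H)) (one_mem _) u.2) (star_mem u.2) (mul_mem (one_mem _) u.2)
  simpa [mulLeft, mulRight] using! h

/-- Along an approximate unit e, σ(u* e u) tends to σ(u* u) = 1. A single such e witnesses that all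
three functionals are nonzero. -/
theorem exists_conjugate_ne_zero (hA : IsClosed (A : Set (H →L[ℂ] H)))
    (hσ : IsPositiveFunctional σ) (hu : strictExt σ (star (u : H →L[ℂ] H) * u) = 1) :
    ∃ e, σ (mulLeft (star u) (mulRight u e)) ≠ 0 := by
  by_contra! h
  obtain ⟨l, hl, -, hl1⟩ := exists_approximateUnit hA
  have h1 := tendsto_conjugate_approximateUnit (u := u) hA hσ hl1
  simp only [h, hu] at h1
  exact zero_ne_one (tendsto_nhds_unique tendsto_const_nhds h1)

theorem isPositiveFunctional_conjugate (hσ : IsPositiveFunctional σ) :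
    IsPositiveFunctional (leftAct u (rightAct σ (star u))) := by
  intro a
  refine (hσ (mulRight u a)).trans_eq (congrArg σ (Subtype.ext ?_))
  simp [mulLeft, mulRight, mul_assoc]

theorem isState_conjugate (hA : IsClosed (A : Set (H →L[ℂ] H)))
    (hσ : IsPositiveFunctional σ) (hu : strictExt σ (star (u : H →L[ℂ] H) * u) = 1) :
    IsState (leftAct u (rightAct σ (star u))) := by
  have hpos := isPositiveFunctional_conjugate (u := u) hσ
  have h1 : strictExt (leftAct u (rightAct σ (star u))) 1 = 1 := by
    rw [hσ.strictExt_leftAct_rightAct hA _ _ (one_mem _), mul_one]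
    exact hu
  refine ⟨hpos, le_antisymm ?_ ?_⟩
  · simpa [h1] using hpos.norm_le_norm_strictExt_one hA
  -- The extension takes the value 1 at the identity, whose norm is at most 1, so the functional has
  -- norm at least 1.
  · have h := hpos.norm_strictExt_le hA (one_mem (multiplier A))
    rw [h1, norm_one] at h
    exact h.trans (mul_le_of_le_one_right (norm_nonneg (leftAct u (rightAct σ (star u))))
      ContinuousLinearMap.norm_id_le)

/-- |σ(a u)|² ≤ σ(a a*) σ(u* u) ≤ ‖a‖². -/
theorem norm_leftAct_le_one (hA : IsClosed (A : Set (H →L[ℂ] H))) (hσ : IsState σ)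
    (hu : strictExt σ (star (u : H →L[ℂ] H) * u) = 1) : ‖leftAct u σ‖ ≤ 1 := by
  refine ContinuousLinearMap.opNorm_le_bound _ zero_le_one fun a => ?_
  have h := hσ.1.strictExt_cauchySchwarz hA (coe_mem_multiplier (star a)) u.2
  rw [hu, norm_one, mul_one] at h
  have h1 : star ((star a : A) : H →L[ℂ] H) * u = (mulRight u a : A) := by simp [mulRight]
  rw [h1, hσ.1.strictExt_coe hA] at h
  refine le_of_sq_le_sq (h.trans ?_) (by positivity)
  refine (hσ.1.norm_strictExt_le hA (mul_mem (star_mem (coe_mem_multiplier (star a)))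
    (coe_mem_multiplier (star a)))).trans ?_
  rw [hσ.2, one_mul, one_mul, CStarRing.norm_star_mul_self, ← sq]
  exact (congrArg (· ^ 2) (norm_star (a : H →L[ℂ] H))).le

theorem norm_rightAct_le_one (hA : IsClosed (A : Set (H →L[ℂ] H))) (hσ : IsState σ)
    (hu : strictExt σ (star (u : H →L[ℂ] H) * u) = 1) : ‖rightAct σ (star u)‖ ≤ 1 := by
  refine ContinuousLinearMap.opNorm_le_bound _ zero_le_one fun a => ?_
  have h := hσ.1.strictExt_cauchySchwarz hA u.2 (coe_mem_multiplier a)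
  rw [hu, norm_one, one_mul] at h
  have h1 : star (u : H →L[ℂ] H) * a = (mulLeft (star u) a : A) := rfl
  rw [h1, hσ.1.strictExt_coe hA] at h
  refine le_of_sq_le_sq (h.trans ?_) (by positivity)
  refine (hσ.1.norm_strictExt_le hA (mul_mem (star_mem (coe_mem_multiplier a))
    (coe_mem_multiplier a))).trans ?_
  rw [hσ.2, one_mul, one_mul, CStarRing.norm_star_mul_self, ← sq]
  exact le_rfl

end CompressedStates

/-! ### Group-like elements modulo the null space and convolution -/

section QuantumGroup

attribute [local irreducible] tensorOp

variable {H : Type*} [NormedAddCommGroup H] [InnerProductSpace ℂ H]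

theorem tensorOp_one_one : tensorOp (1 : H →L[ℂ] H) (1 : H →L[ℂ] H) = 1 := by
  ext x
  refine denseRange_ofAlg.induction_on x
    (isClosed_eq (ContinuousLinearMap.continuous _) (ContinuousLinearMap.continuous _)) fun x => ?_
  rw [tensorOp_ofAlg]
  exact congrArg ofAlg (DFunLike.congr_fun TensorProduct.mapL_id_id x)

theorem continuous_tmul_left (η : H) : Continuous fun ξ : H => tmul ξ η :=
  ofAlg.continuous.comp (TensorProduct.continuous_tmul.comp (continuous_id.prodMk continuous_const))

theorem continuous_tmul_right (ξ : H) : Continuous fun η : H => tmul ξ η :=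
  ofAlg.continuous.comp (TensorProduct.continuous_tmul.comp (continuous_const.prodMk continuous_id))

variable [CompleteSpace H]

theorem IsNondegenerate.mem_of_forall {A : NonUnitalStarSubalgebra ℂ (H →L[ℂ] H)}
    (hA : IsNondegenerate A) {S : Submodule ℂ H} (hS : IsClosed (S : Set H))
    (h : ∀ a ∈ A, ∀ ξ, a ξ ∈ S) (ξ : H) : ξ ∈ S := by
  have h1 : (Submodule.span ℂ {x : H | ∃ a ∈ A, ∃ ξ : H, x = a ξ}).topologicalClosure ≤ S := by
    refine Submodule.topologicalClosure_minimal _ (Submodule.span_le.2 ?_) hS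
    rintro _ ⟨a, ha, ξ, rfl⟩
    exact h a ha ξ
  rw [hA] at h1
  exact h1 trivial

/-- A closed subspace of `H ⊗ H` containing all `(a ξ) ⊗ (b η)` is everything. -/
theorem mem_of_forall_tmul_mem {A : NonUnitalStarSubalgebra ℂ (H →L[ℂ] H)}
    (hA : IsNondegenerate A) {S : Submodule ℂ (HTensor H H)}
    (hS : IsClosed (S : Set (HTensor H H)))
    (h : ∀ a ∈ A, ∀ b ∈ A, ∀ ξ η : H, tmul (a ξ) (b η) ∈ S) (x : HTensor H H) : x ∈ S := by
  let f : H →ₗ[ℂ] H →ₗ[ℂ] HTensor H H := (TensorProduct.mk ℂ H H).compr₂ ofAlg.toLinearMap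
  have h1 : ∀ ξ, ∀ b ∈ A, ∀ η : H, tmul ξ (b η) ∈ S := fun ξ b hb η =>
    hA.mem_of_forall (S := S.comap (f.flip (b η))) (hS.preimage (continuous_tmul_left _))
      (fun a ha ξ => h a ha b hb ξ η) ξ
  have h2 : ∀ ξ η, tmul ξ η ∈ S := fun ξ η =>
    hA.mem_of_forall (S := S.comap (f ξ)) (hS.preimage (continuous_tmul_right _))
      (fun b hb η => h1 ξ b hb η) η
  refine denseRange_ofAlg.induction_on (p := fun x => x ∈ S) x hS fun t => ?_
  induction t with
  | zero => rw [map_zero]; exact zero_mem _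
  | add s t hs ht => rw [map_add]; exact add_mem hs ht
  | tmul ξ η => exact h2 ξ η

namespace LCQG

variable (G : LCQG H)

theorem minTensor_subset_closure_comul :
    (minTensor G.alg G.alg : Set (HTensor H H →L[ℂ] HTensor H H)) ⊆
      closure (Submodule.span ℂ {T : HTensor H H →L[ℂ] HTensor H H |
        ∃ a : G.alg, ∃ X ∈ minTensor G.alg G.alg, T = G.Δ a * X} :
          Set (HTensor H H →L[ℂ] HTensor H H)) :=
  G.comul_nondegenerate.ge

/-- Nondegeneracy of Δ is given inside A ⊗ A. It passes to vectors because (A ⊗ A)(H ⊗ H) spans a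
dense subspace, by nondegeneracy of A on H. -/
theorem dense_span_comul :
    Dense (Submodule.span ℂ {x : HTensor H H | ∃ a ξ, x = G.Δ a ξ} : Set (HTensor H H)) := by
  set S := (Submodule.span ℂ {x : HTensor H H | ∃ a ξ, x = G.Δ a ξ}).topologicalClosure
  have hS : IsClosed (S : Set (HTensor H H)) := isClosed_closure
  have key : ∀ X ∈ minTensor G.alg G.alg, ∀ x, X x ∈ S := by
    intro X hX x
    have hle : Submodule.span ℂ {T : HTensor H H →L[ℂ] HTensor H H |
        ∃ a : G.alg, ∃ X ∈ minTensor G.alg G.alg, T = G.Δ a * X} ≤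
        S.comap (ContinuousLinearMap.apply ℂ (HTensor H H) x).toLinearMap := by
      refine Submodule.span_le.2 ?_
      rintro _ ⟨a, Y, -, rfl⟩
      exact subset_closure (Submodule.subset_span ⟨a, Y x, rfl⟩)
    exact (hS.preimage (ContinuousLinearMap.apply ℂ (HTensor H H) x).continuous
      ).closure_subset_iff.2 hle (G.minTensor_subset_closure_comul hX)
  intro x
  refine mem_of_forall_tmul_mem G.nondegenerate_alg hS (fun a ha b hb ξ η => ?_) x
  rw [← tensorOp_tmul]
  exact key _ (tensorOp_mem_minTensor ha hb) _

variable {G} {σ : StrongDual ℂ G.alg} {u v : multiplier G.alg}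

/-- The multiplier `u ⊗ v`. -/
def tensorMultiplier (u v : multiplier G.alg) : multiplier (minTensor G.alg G.alg) :=
  ⟨tensorOp (u : H →L[ℂ] H) (v : H →L[ℂ] H), tensorOp_mem_multiplier u.2 v.2⟩

theorem tensorFunctional_compress (v : multiplier G.alg) :
    tensorFunctional (leftAct u (rightAct σ v)) (leftAct u (rightAct σ v)) =
      leftAct (tensorMultiplier u u)
        (rightAct (tensorFunctional σ σ) (tensorMultiplier v v)) := by
  refine minTensor_functional_ext fun a b => ?_
  rw [tensorFunctional_elemTensor]
  have h : mulLeft (tensorMultiplier v v) (mulRight (tensorMultiplier u u) (elemTensor a b)) =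
      elemTensor (mulLeft v (mulRight u a)) (mulLeft v (mulRight u b)) := by
    refine Subtype.ext ?_
    change tensorOp (v : H →L[ℂ] H) (v : H →L[ℂ] H) *
      (tensorOp (a : H →L[ℂ] H) (b : H →L[ℂ] H) * tensorOp (u : H →L[ℂ] H) (u : H →L[ℂ] H)) = _
    rw [tensorOp_mul, tensorOp_mul]
    rfl
  exact ((congrArg (tensorFunctional σ σ) h).trans (tensorFunctional_elemTensor _ _ _ _)).symm

/-- `u` is group-like modulo the null space of `σ ⊗ σ`. -/
def IsGroupLikeMod (σ : StrongDual ℂ G.alg) (u : multiplier G.alg) : Prop :=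
  homExt G.Δ (u : H →L[ℂ] H) - tensorOp (u : H →L[ℂ] H) (u : H →L[ℂ] H) ∈
    nullSpace (tensorFunctional σ σ)

theorem isPositiveFunctional_tensor (hσ : IsPositiveFunctional σ) :
    IsPositiveFunctional (tensorFunctional σ σ) :=
  hσ.tensorFunctional G.isClosed_alg G.isClosed_alg hσ

theorem isGroupLikeMod_one (hσ : IsPositiveFunctional σ) :
    IsGroupLikeMod σ (1 : multiplier G.alg) := by
  have h0 : homExt G.Δ ((1 : multiplier G.alg) : H →L[ℂ] H) -
      tensorOp ((1 : multiplier G.alg) : H →L[ℂ] H) ((1 : multiplier G.alg) : H →L[ℂ] H) = 0 :=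
    sub_eq_zero.2 ((homExt_one G.isClosed_alg G.dense_span_comul).trans tensorOp_one_one.symm)
  rw [IsGroupLikeMod, h0]
  refine ⟨zero_mem _, ?_⟩
  rw [mul_zero]
  have h := (isPositiveFunctional_tensor hσ).norm_strictExt_le isClosed_minTensor (zero_mem _)
  rw [norm_zero, mul_zero] at h
  simpa using h

theorem strictExt_tensor_comul (hσ : IsPositiveFunctional σ) (hσi : ∀ a, G.conv σ σ a = σ a)
    (hu : IsGroupLikeMod σ u) (hv : IsGroupLikeMod σ v) (a : G.alg) :
    strictExt (tensorFunctional σ σ)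
      (star (tensorOp (v : H →L[ℂ] H) (v : H →L[ℂ] H)) * G.Δ a *
        tensorOp (u : H →L[ℂ] H) (u : H →L[ℂ] H)) = σ (mulLeft (star v) (mulRight u a)) :=
  (strictExt_star_mul_starHom_mul G.isClosed_alg isClosed_minTensor G.dense_span_comul
    G.comul_mem (isPositiveFunctional_tensor hσ) (tensorOp_mem_multiplier u.2 u.2)
    (tensorOp_mem_multiplier v.2 v.2) hu hv a).trans (hσi _)

/-- Keeping u and v separate covers the two-sided compression u.σ.u* and, with one of them equal to
1, the one-sided translates. -/
theorem conv_compress (hσ : IsPositiveFunctional σ) (hσi : ∀ a, G.conv σ σ a = σ a)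
    (hu : IsGroupLikeMod σ u) (hv : IsGroupLikeMod σ v) (a : G.alg) :
    G.conv (leftAct u (rightAct σ (star v))) (leftAct u (rightAct σ (star v))) a =
      leftAct u (rightAct σ (star v)) a := by
  rw [conv, tensorFunctional_compress, (isPositiveFunctional_tensor
    hσ).strictExt_leftAct_rightAct isClosed_minTensor _ _ (G.comul_mem a)]
  refine Eq.trans ?_ (strictExt_tensor_comul hσ hσi hu hv a)
  rw [star_tensorOp]
  rfl

/-- Evaluate (σ ⊗ σ)((u ⊗ u)* Δ(e) (u ⊗ u)) = σ(u* e u) along an approximate unit e. Since Δ(e)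
tends strictly to 1, the left side tends to (σ ⊗ σ)(u* u ⊗ u* u), which factors. -/
theorem strictExt_star_mul_self_eq_mul (hσ : IsPositiveFunctional σ)
    (hσi : ∀ a, G.conv σ σ a = σ a) (hu : IsGroupLikeMod σ u) :
    strictExt σ (star (u : H →L[ℂ] H) * u) =
      strictExt σ (star (u : H →L[ℂ] H) * u) * strictExt σ (star (u : H →L[ℂ] H) * u) := by
  obtain ⟨l, hl, -, hl1⟩ := exists_approximateUnit G.isClosed_alg
  have h1 := tendsto_conjugate_approximateUnit (u := u) G.isClosed_alg hσ hl1
  have hw := tensorOp_mem_multiplier u.2 u.2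
  have h2 := strictTendsto_starHom (Φ := G.Δ) G.isClosed_alg G.minTensor_subset_closure_comul hl1
  have h3 := ((StrictTendsto.const (star (tensorOp (u : H →L[ℂ] H) (u : H →L[ℂ] H)))).mul h2
    (star_mem hw) (one_mem _)).mul (.const (tensorOp (u : H →L[ℂ] H) (u : H →L[ℂ] H)))
    (mul_mem (star_mem hw) (one_mem _)) hw
  have h4 := (isPositiveFunctional_tensor hσ).tendsto_strictExt isClosed_minTensor
    (fun e => mul_mem (mul_mem (star_mem hw) (G.comul_mem e)) hw)
    (mul_mem (mul_mem (star_mem hw) (one_mem _)) hw) h3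
  simp only [strictExt_tensor_comul hσ hσi hu hu] at h4
  have h5 := tendsto_nhds_unique h1 h4
  rwa [mul_one, star_tensorOp, tensorOp_mul, hσ.strictExt_tensorOp G.isClosed_alg G.isClosed_alg hσ
    (mul_mem (star_mem u.2) u.2) (mul_mem (star_mem u.2) u.2)] at h5

end LCQG

end QuantumGroup

end QG

end

theorem mainTheorem7 {H : Type*} [NormedAddCommGroup H] [InnerProductSpace ℂ H] [CompleteSpace H]
    (G : QG.LCQG H) (hG : G.IsCoamenable)
    (σ : StrongDual ℂ G.alg) (hσ : G.IsIdempotentState σ)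
    (u : QG.multiplier G.alg)
    (hu : QG.homExt G.Δ (u : H →L[ℂ] H) - QG.tensorOp (u : H →L[ℂ] H) (u : H →L[ℂ] H) ∈
      QG.nullSpace (QG.tensorFunctional σ σ)) :
    (QG.strictExt σ (star (u : H →L[ℂ] H) * (u : H →L[ℂ] H)) = 1 ∨
      QG.strictExt σ (star (u : H →L[ℂ] H) * (u : H →L[ℂ] H)) = 0) ∧
    (QG.strictExt σ (star (u : H →L[ℂ] H) * (u : H →L[ℂ] H)) = 1 →
      G.IsIdempotentState (QG.leftAct u (QG.rightAct σ (star u))) ∧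
      G.IsContractiveIdempotent (QG.leftAct u σ) ∧
      G.IsContractiveIdempotent (QG.rightAct σ (star u))) := by
  obtain ⟨hst, -, hσi⟩ := hσ
  have hpos := hst.1
  have hg1 := QG.LCQG.isGroupLikeMod_one (G := G) hpos
  refine ⟨?_, fun hc => ?_⟩
  · have h := QG.LCQG.strictExt_star_mul_self_eq_mul hpos hσi hu
    rcases eq_or_ne (QG.strictExt σ (star (u : H →L[ℂ] H) * (u : H →L[ℂ] H))) 0 with h0 | h0
    · exact Or.inr h0
    · exact Or.inl (mul_left_cancel₀ h0 (by rw [← h, mul_one]))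
  · obtain ⟨e, he⟩ := QG.exists_conjugate_ne_zero G.isClosed_alg hpos hc
    have hL : QG.leftAct u (QG.rightAct σ (star 1)) = QG.leftAct u σ := by
      ext a
      exact congrArg σ (Subtype.ext (by simp [QG.mulLeft]))
    have hR : QG.leftAct 1 (QG.rightAct σ (star u)) = QG.rightAct σ (star u) := by
      ext a
      exact congrArg (QG.rightAct σ (star u)) (Subtype.ext (mul_one _))
    refine ⟨⟨QG.isState_conjugate G.isClosed_alg hpos hc, fun h => he ?_,
      QG.LCQG.conv_compress hpos hσi hu hu⟩,
      ⟨QG.norm_leftAct_le_one G.isClosed_alg hst hc, fun h => he ?_, fun a => ?_⟩,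
      ⟨QG.norm_rightAct_le_one G.isClosed_alg hst hc, fun h => he ?_, fun a => ?_⟩⟩
    · exact DFunLike.congr_fun h e
    -- If u.σ vanished, its value σ(u* e u) at u* e would be zero; for σ.u* the same value is
    -- obtained at e u.
    · refine (congrArg σ (Subtype.ext ?_)).trans (DFunLike.congr_fun h (QG.mulLeft (star u) e))
      simp [QG.mulLeft, QG.mulRight, mul_assoc]
    · have h := QG.LCQG.conv_compress hpos hσi hu hg1 a
      rwa [hL] at h
    · exact DFunLike.congr_fun h (QG.mulRight u e)
    · have h := QG.LCQG.conv_compress hpos hσi hg1 hu a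
      rwa [hR] at h
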